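/- **Setting.** Let $X$ be a pure $d$-dimensional finite simplicial complex, $X(i)$ its faces with $i+1$ elements, and $\mathcal D_d$ a probability distribution on $X(d)$ giving positive probability to every $d$-face. For $-1\le i\le d$ let $\mathcal D_i$ be the distribution on $X(i)$ obtained by choosing $t\sim\mathcal D_d$ and removing $d-i$ random points. For a weighted bipartite graph $G=(U,V,w)$ let $w_u=\sum_v w_{uv}$, $w_v=\sum_u w_{uv}$, $(Af)(v)=\sum_u w_{uv}f(u)/w_v$, and $\lambda(G)=\sup\{\|Af\|/\|f\| : f\ne 0,\ \sum_u w_uf(u)=0\}$ (norms weighted by the vertex weights, value $0$ if there is no such $f$); for a non-bipartite weighted graph take $U=V$. $X$ is a *$\gamma$-two-sided spectral expander* if for every face $s\in X(i)$ with $-1\le i<d-1$ the link graph $X_s$, with vertices $\{x\notin s: s\cup\{x\}\in X(i+1)\}$ and edge weights $w_s(x,y)=\Pr_{t\sim\mathcal D_{i+2}}[t=s\cup\{x,y\}\mid t\supset s]$, $x \neq y$, satisfies $\lambda(X_s)\le\gamma$. Let $d\ge m_2-1>m_1-1\ge 0$ with $m_2>2$, and $V_2=X(m_2-1)$, $V_1=X(m_1-1)$,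 $V_0=X(0)$. Let $\Pi$ be the distribution of $(T,S,x)$, where $T\sim\Pi_2=\mathcal D_{m_2-1}$, $S$ is a uniformly random face in $V_1$ contained in $T$, and $x$ is a uniformly random element of $S$; $\Pi_1,\Pi_0$ denote the marginals on $V_1,V_0$. Let $G_{2,1}=(V_2,V_1)$ and $G_{1,0}=(V_1,V_0)$ be the inclusion graphs weighted by the marginals of $\Pi$. For $T\in V_2$ let $X_{|T}=(U,T,E)$ be the inclusion graph between $U=\{S\in V_1:S\subseteq T\}$ and $T$, weighted by $(\Pi\mid\Pi_2=T)$. **Lemma 5.3.** 1. There is an absolute constant $C>0$ such that for all $X,\mathcal D_d,m_1,m_2$ as above: * if $X$ is a $\gamma$-two-sided spectral expander, then $\lambda^2(G_{1,0})\le \frac1{m_1}+C\,m_1\gamma$ and $\lambda^2(G_{2,1})\le\frac{m_1}{m_2}+C\,m_1m_2\gamma$; * for every $T\in V_2$, $(\Pi_0\mid\Pi_2=T)$ is uniform on $T$, and $\lambda^2(X_{|T})\le\frac1{m_1}\cdot\frac{m_2-m_1}{m_2-1}$. 2. Suppose in addition that $X$ is the truncation to dimension $d$ of a $k$-dimensional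 Lubotzky–Samuels–Vishne type complex $Y$. That is, $Y$ is a finite quotient $\Gamma\backslash\mathcal B$ of the Bruhat–Tits building $\mathcal B$ of $PGL_{k+1}(\mathbb F_q((t)))$ by a group $\Gamma$ each of whose orbits meets the closed star of every vertex in at most one point; $X(i)=Y(i)$ for $i\le d$; and $\mathcal D_d$ is induced from the uniform distribution on $Y(k)$. Suppose also that $0<\gamma\le\frac12$, $k\le K d/\gamma$ and $q\le K/\gamma^2$ for a constant $K>0$. Then $\mathcal D_0$ is uniform on $X(0)$, and there is an integer $D\le(1/\gamma)^{C_K d^2/\gamma^2}$, with $C_K$ depending only on $K$, such that $\Pi_1$ is $D$-flat (for some positive integer $R$, $\Pi_1(S)\in\{\frac1R,\dots,\frac DR\}$ for every $S\in V_1$) and $|X(d)|/|X(0)|\le D$. -/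

import Mathlib

open scoped LaurentSeries PowerSeries

universe u v

noncomputable section

namespace HDX

/-! ### Weighted bipartite graphs and their second singular value -/

section Bipartite

variable {U V : Type*}

/-- Weight of a left vertex in the bipartite graph with right side `B` and edge weights `w`. -/
def leftWeight (B : Finset V) (w : U → V → ℝ) (a : U) : ℝ := ∑ b ∈ B, w a b

/-- Weight of a right vertex in the bipartite graph with left side `A` and edge weights `w`. -/
def rightWeight (A : Finset U) (w : U → V → ℝ) (b : V) : ℝ := ∑ a ∈ A, w a b

/-- The operator `(A f)(b) = E_{a | b} [f a]`. -/
def walkOp (A : Finset U) (w : U → V → ℝ) (f : U → ℝ) (b : V) : ℝ :=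
  (∑ a ∈ A, w a b * f a) / rightWeight A w b

/-- The second singular value `λ(G) = sup ‖A f‖ / ‖f‖` of the weighted bipartite graph `G` with sides
`A`, `B` and edge weights `w`, over nonzero `f` orthogonal to the constants, all norms being weighted
by the vertex weights. It does not change when `w` is rescaled, the supremum is over a set bounded by
`1`, and it is `0` when there is no such `f` (one vertex). A non-bipartite weighted graph is treated
by taking `A = B`; for a symmetric `w` this is the second largest absolute value of an eigenvalue. -/
def lambda (A : Finset U) (B : Finset V) (w : U → V → ℝ) : ℝ :=
  sSup {r : ℝ | ∃ f : U → ℝ,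
    0 < ∑ a ∈ A, leftWeight B w a * f a ^ 2 ∧
    ∑ a ∈ A, leftWeight B w a * f a = 0 ∧
    r = √(∑ b ∈ B, rightWeight A w b * walkOp A w f b ^ 2) /
        √(∑ a ∈ A, leftWeight B w a * f a ^ 2)}

end Bipartite

/-- A distribution `P` on the finite set `S` is `D`-flat: for some `R`, every atom of `P` is one of
`1/R, 2/R, …, D/R`. -/
def IsFlat {β : Type*} (S : Finset β) (P : β → ℝ) (D : ℕ) : Prop :=
  ∃ R : ℕ, 0 < R ∧ ∀ s ∈ S, ∃ j : ℕ, 1 ≤ j ∧ j ≤ D ∧ P s = (j : ℝ) / (R : ℝ)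

/-! ### Pure simplicial complexes with a distribution on the top faces -/

/-- A pure `d`-dimensional finite simplicial complex; the empty face is a face. -/
structure PureComplex (V : Type u) (d : ℕ) where
  faces : Finset (Finset V)
  nonempty : faces.Nonempty
  down_closed : ∀ s ∈ faces, ∀ t : Finset V, t ⊆ s → t ∈ faces
  card_le : ∀ s ∈ faces, s.card ≤ d + 1
  pure : ∀ s ∈ faces, ∃ t ∈ faces, s ⊆ t ∧ t.card = d + 1

/-- The faces with `m` elements, that is, of dimension `m - 1`. -/
def PureComplex.layer {V : Type u} {d : ℕ} (X : PureComplex V d) (m : ℕ) : Finset (Finset V) :=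
  X.faces.filter (fun s => s.card = m)

/-- A pure `d`-dimensional complex with a probability distribution on its `d`-faces. Every `d`-face
has positive probability, so that conditioning on containing a given face makes sense. -/
structure WeightedComplex (V : Type u) (d : ℕ) extends PureComplex V d where
  prob : Finset V → ℝ
  prob_pos : ∀ t ∈ toPureComplex.layer (d + 1), 0 < prob t
  prob_sum : ∑ t ∈ toPureComplex.layer (d + 1), prob t = 1

namespace WeightedComplex

variable {V : Type u} [DecidableEq V] {d : ℕ} (X : WeightedComplex V d)

/-- The vertices (as points of the ground set). -/
def verts : Finset V := X.faces.biUnion id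

/-- Probability of the face `s` under the distribution on faces of the same size as `s`: choose a
top face at random, then a uniformly random subset of it with `s.card` elements. -/
def faceProb (s : Finset V) : ℝ :=
  ∑ t ∈ (X.layer (d + 1)).filter (fun t => s ⊆ t), X.prob t / ((d + 1).choose s.card : ℝ)

/-- Vertices of the link graph of `s`. -/
def linkVerts (s : Finset V) : Finset V :=
  X.verts.filter (fun x => x ∉ s ∧ insert x s ∈ X.faces)

/-- Edge weights of the link graph of `s`: the probability that a random face with two more elements
than `s` is `s ∪ {x, y}`, given that it contains `s`. -/
def linkWeight (s : Finset V) (x y : V) : ℝ :=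
  if x ≠ y ∧ x ∉ s ∧ y ∉ s then
    X.faceProb (insert x (insert y s)) /
      ∑ t ∈ (X.layer (s.card + 2)).filter (fun t => s ⊆ t), X.faceProb t
  else 0

/-- `γ`-two-sided spectral expander: the link graph of every face of dimension `< d - 1`, the empty
face (of dimension `-1`) included, satisfies `λ ≤ γ`. -/
def IsTwoSidedExpander (γ : ℝ) : Prop :=
  ∀ s ∈ X.faces, s.card < d →
    lambda (X.linkVerts s) (X.linkVerts s) (X.linkWeight s) ≤ γ

/-! ### The inclusion graph on three layers

`V₂ = X.layer m₂`, `V₁ = X.layer m₁` and `V₀ = X.verts`; edges are inclusions. -/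

/-- Neighbours in `V₁` of the face `T`: the left side of the graph `X_{|T}`. -/
def lowerNbrs (m₁ : ℕ) (T : Finset V) : Finset (Finset V) :=
  (X.layer m₁).filter (fun S => S ⊆ T)

/-- The distribution `Π` on paths `(T, S, x) ∈ V₂ × V₁ × V₀`: `T` is a random face with `m₂`
elements, `S` is a uniformly random neighbour of `T`, and `x` is a uniformly random neighbour
of `S`. -/
def pathProb (m₁ : ℕ) (T S : Finset V) (x : V) : ℝ :=
  if S ⊆ T ∧ x ∈ S then
    X.faceProb T * (1 / ((X.lowerNbrs m₁ T).card : ℝ)) *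
      (1 / ((X.verts.filter (fun y => y ∈ S)).card : ℝ))
  else 0

/-- Edge weights of `G_{2,1} = (V₂, V₁)`: the marginal of `Π` on `(T, S)`. -/
def weight21 (m₁ : ℕ) (T S : Finset V) : ℝ := ∑ x ∈ X.verts, X.pathProb m₁ T S x

/-- Edge weights of `G_{1,0} = (V₁, V₀)`: the marginal of `Π` on `(S, x)`. -/
def weight10 (m₁ m₂ : ℕ) (S : Finset V) (x : V) : ℝ := ∑ T ∈ X.layer m₂, X.pathProb m₁ T S x

/-- `Π₁`, the marginal of `Π` on `V₁`. -/
def pi1 (m₁ m₂ : ℕ) (S : Finset V) : ℝ :=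
  ∑ T ∈ X.layer m₂, ∑ x ∈ X.verts, X.pathProb m₁ T S x

/-- Edge weights of `X_{|T}`: the distribution of `(S, x)` under `Π` given that the first
coordinate is `T`. -/
def localWeight (m₁ : ℕ) (T S : Finset V) (x : V) : ℝ := X.pathProb m₁ T S x / X.faceProb T

/-- `(Π₀ | Π₂ = T)`. -/
def pi0Given (m₁ : ℕ) (T : Finset V) (x : V) : ℝ := ∑ S ∈ X.layer m₁, X.localWeight m₁ T S x

/-- `λ(G_{2,1})` -/
def lambda21 (m₁ m₂ : ℕ) : ℝ := lambda (X.layer m₂) (X.layer m₁) (X.weight21 m₁)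

/-- `λ(G_{1,0})` -/
def lambda10 (m₁ m₂ : ℕ) : ℝ := lambda (X.layer m₁) X.verts (X.weight10 m₁ m₂)

/-- `λ(X_{|T})`, where `X_{|T}` has the sides `{S ∈ V₁ : S ⊆ T}` and `T`. -/
def lambdaLocal (m₁ : ℕ) (T : Finset V) : ℝ :=
  lambda (X.lowerNbrs m₁ T) T (X.localWeight m₁ T)

/-- The top distribution is uniform. -/
def IsUniform : Prop :=
  ∀ t ∈ X.layer (d + 1), X.prob t = 1 / ((X.layer (d + 1)).card : ℝ)

/-- `X` is the truncation of the `k`-dimensional complex `Y` to the faces of dimension at most `d`,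
with the distribution on `d`-faces induced from that of `Y`. -/
def IsTruncationOf {k : ℕ} (Y : WeightedComplex V k) : Prop :=
  X.faces = Y.faces.filter (fun s => s.card ≤ d + 1) ∧
    ∀ s ∈ X.layer (d + 1), X.prob s = Y.faceProb s

end WeightedComplex

/-! ### Quotients of the Bruhat–Tits building of `PGL_n(𝔽_q((t)))` -/

section Building

variable (𝔽 : Type v) [Field 𝔽] (n : ℕ)

/-- A full-rank `𝔽⟦t⟧`-lattice in `𝔽((t))ⁿ`. -/
structure BTLattice where
  carrier : Submodule 𝔽⟦X⟧ (Fin n → 𝔽⸨X⸩)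
  fg : carrier.FG
  span_eq_top : Submodule.span 𝔽⸨X⸩ (carrier : Set (Fin n → 𝔽⸨X⸩)) = ⊤

/-- Homothety of lattices: `M = c⁻¹ L` for some nonzero scalar `c`. -/
def homothety : Setoid (BTLattice 𝔽 n) where
  r L M := ∃ c : 𝔽⸨X⸩, c ≠ 0 ∧ ∀ x, x ∈ M.carrier ↔ c • x ∈ L.carrier
  iseqv :=
    { refl := fun _ => ⟨1, one_ne_zero, fun x => by rw [one_smul]⟩
      symm := by
        rintro L M ⟨c, hc, h⟩
        exact ⟨c⁻¹, inv_ne_zero hc, fun x => by rw [h, smul_inv_smul₀ hc]⟩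
      trans := by
        rintro L M N ⟨c, hc, h⟩ ⟨e, he, h'⟩
        exact ⟨c * e, mul_ne_zero hc he, fun x => by rw [h', h, mul_smul]⟩ }

/-- Vertices of the building: homothety classes of lattices. -/
def BTVertex : Type v := Quotient (homothety 𝔽 n)

variable {𝔽 n}

/-- The homothety class of a lattice. -/
def BTLattice.toVertex (L : BTLattice 𝔽 n) : BTVertex 𝔽 n := Quotient.mk (homothety 𝔽 n) L

/-- Simplices of the building: sets of vertices with representatives that form a chain
`L₀ ⊋ L₁ ⊋ ⋯ ⊋ L_j ⊋ t L₀`. -/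
def IsSimplex (σ : Set (BTVertex 𝔽 n)) : Prop :=
  ∃ r : BTVertex 𝔽 n → BTLattice 𝔽 n,
    (∀ a ∈ σ, (r a).toVertex = a) ∧
    ∀ a ∈ σ, ∀ b ∈ σ,
      ((r a).carrier ≤ (r b).carrier ∨ (r b).carrier ≤ (r a).carrier) ∧
      ∀ x ∈ (r a).carrier, (PowerSeries.X : 𝔽⟦X⟧) • x ∈ (r b).carrier

/-- Two vertices of the building lie in the same orbit of the group `Γ`. -/
def SameOrbit (Γ : Subgroup (Matrix.GeneralLinearGroup (Fin n) 𝔽⸨X⸩)) (a b : BTVertex 𝔽 n) : Prop :=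
  ∃ g ∈ Γ, ∃ L M : BTLattice 𝔽 n, L.toVertex = a ∧ M.toVertex = b ∧
    ∀ x, x ∈ L.carrier ↔ Matrix.mulVec (g : Matrix (Fin n) (Fin n) 𝔽⸨X⸩) x ∈ M.carrier

variable (𝔽)

/-- The finite `k`-dimensional complex `Y` is (isomorphic to) a quotient `Γ \ 𝓑` of the
`k`-dimensional building `𝓑` of `PGL_{k+1}(𝔽((t)))` by a group `Γ` whose orbits meet the closed star
of every vertex in at most one point (so that the quotient is again a simplicial complex, locally
isomorphic to `𝓑`). The Ramanujan complexes of Lubotzky, Samuels and Vishne are of this kind. -/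
def IsBuildingQuotient {V : Type u} {k : ℕ} (Y : PureComplex V k) : Prop :=
  ∃ (Γ : Subgroup (Matrix.GeneralLinearGroup (Fin (k + 1)) 𝔽⸨X⸩)) (p : BTVertex 𝔽 (k + 1) → V),
    (∀ a b, p a = p b ↔ SameOrbit Γ a b) ∧
    (∀ s : Finset V, s ∈ Y.faces ↔ ∃ σ : Set (BTVertex 𝔽 (k + 1)), IsSimplex σ ∧ p '' σ = ↑s) ∧
    ∀ a b c, IsSimplex {a, b} → IsSimplex {a, c} → SameOrbit Γ b c → b = c

end Building

end HDX

end

/-! The spectral bounds come from a local-to-global argument. The walk operator of an inclusion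
graph has an adjoint that averages a function on small faces over the subsets of a larger face. It
is enough to bound this adjoint on functions of mean zero, because an operator and its adjoint have
the same norm (`AvgBound.walkOp_le`).

For consecutive layers, square the average of `g` over the facets of a face. The diagonal terms give
the squared norm of `g`. The cross terms pair two facets sharing a face `R` of codimension two, so
they form the quadratic form of the link graph of `R`. The link expansion leaves a mean part, which
is the squared norm of the down operator one layer below and is controlled by induction, plus an
error of order `γ` (`UpBound.succ`). The recursion has the exact solution `k / (k + 1) + k * γ / 2`.
Averages compose, so these factors multiply; the main terms telescope to `i / j`, and the errors
stay below `i * j * γ` (`IsTwoSidedExpander.upBound`). The marginals of the path distribution are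
the distributions of the complex itself, so these estimates apply to both inclusion graphs.

Inside one face `T` everything is uniform. The bound there is the variance formula for the mean of a
sample drawn without replacement (`sum_powersetCard_sq_sum`).

For building quotients, the linear group acts transitively on lattices, so every vertex of the
building lies in the same number of chambers. Chambers at the class of `L` are complete flags in `L
/ tL`, and a flag is determined by a tuple of `n` vectors of `𝔽ⁿ`, so there are at most `q ^ (n ^
2)` of them. The star condition carries this count to the quotient (`card_layer_filter_mem`). A
constant vertex degree gives uniformity on vertices. The same degree bounds the number of top faces
through any nonempty face, which gives flatness, and it bounds the number of faces per vertex. -/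

namespace HDX

/-! ### Weighted bipartite graphs: adjoint bounds and quadratic forms. -/

section Bipartite

variable {U V : Type*}

/-- The averaging operator from functions on `B` to functions on `A` contracts the squared norm of
functions orthogonal to the constants by the factor `c`. -/
def AvgBound (A : Finset U) (B : Finset V) (w : U → V → ℝ) (c : ℝ) : Prop :=
  ∀ g : V → ℝ, ∑ b ∈ B, rightWeight A w b * g b = 0 →
    ∑ a ∈ A, (∑ b ∈ B, w a b * g b) ^ 2 / leftWeight B w a ≤
      c * ∑ b ∈ B, rightWeight A w b * g b ^ 2

theorem leftWeight_nonneg {A : Finset U} {B : Finset V} {w : U → V → ℝ}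
    (hw : ∀ a ∈ A, ∀ b ∈ B, 0 ≤ w a b) {a : U} (ha : a ∈ A) : 0 ≤ leftWeight B w a :=
  Finset.sum_nonneg fun b hb => hw a ha b hb

theorem rightWeight_nonneg {A : Finset U} {B : Finset V} {w : U → V → ℝ}
    (hw : ∀ a ∈ A, ∀ b ∈ B, 0 ≤ w a b) {b : V} (hb : b ∈ B) : 0 ≤ rightWeight A w b :=
  Finset.sum_nonneg fun a ha => hw a ha b hb

theorem rightWeight_mul_walkOp {A : Finset U} {B : Finset V} {w : U → V → ℝ}
    (hw : ∀ a ∈ A, ∀ b ∈ B, 0 ≤ w a b) (f : U → ℝ) {b : V} (hb : b ∈ B) :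
    rightWeight A w b * walkOp A w f b = ∑ a ∈ A, w a b * f a := by
  unfold walkOp
  by_cases h : rightWeight A w b = 0
  · rw [h, zero_mul]
    have h0 := (Finset.sum_eq_zero_iff_of_nonneg fun a ha => hw a ha b hb).1 h
    exact (Finset.sum_eq_zero fun a ha => by rw [h0 a ha, zero_mul]).symm
  · field_simp

/-- Weighted Cauchy–Schwarz. Since division by zero gives zero, the term at a vanishing weight
disappears on the right, and `hh` makes it disappear on the left too. -/
theorem sum_mul_sq_le {ι : Type*} (s : Finset ι) (p f h : ι → ℝ) (hp : ∀ i ∈ s, 0 ≤ p i)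
    (hh : ∀ i ∈ s, p i = 0 → h i = 0) :
    (∑ i ∈ s, f i * h i) ^ 2 ≤ (∑ i ∈ s, p i * f i ^ 2) * ∑ i ∈ s, h i ^ 2 / p i := by
  refine Finset.sum_sq_le_sum_mul_sum_of_sq_le_mul s
    (fun i hi => mul_nonneg (hp i hi) (sq_nonneg _))
    (fun i hi => div_nonneg (sq_nonneg _) (hp i hi)) fun i hi => le_of_eq ?_
  by_cases h0 : p i = 0
  · simp [h0, hh i hi h0]
  · field_simp

/-- The squared norm of the walk operator is bounded by any bound for its adjoint. -/
theorem AvgBound.walkOp_le {A : Finset U} {B : Finset V} {w : U → V → ℝ} {c : ℝ}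
    (hw : ∀ a ∈ A, ∀ b ∈ B, 0 ≤ w a b) (hc : 0 ≤ c) (h : AvgBound A B w c) (f : U → ℝ)
    (hf : ∑ a ∈ A, leftWeight B w a * f a = 0) :
    ∑ b ∈ B, rightWeight A w b * walkOp A w f b ^ 2 ≤
      c * ∑ a ∈ A, leftWeight B w a * f a ^ 2 := by
  set g := walkOp A w f with hg
  set N := ∑ b ∈ B, rightWeight A w b * g b ^ 2 with hN
  set F := ∑ a ∈ A, leftWeight B w a * f a ^ 2 with hF
  have hN0 : 0 ≤ N :=
    Finset.sum_nonneg fun b hb => mul_nonneg (rightWeight_nonneg hw hb) (sq_nonneg _)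
  have hF0 : 0 ≤ F :=
    Finset.sum_nonneg fun a ha => mul_nonneg (leftWeight_nonneg hw ha) (sq_nonneg _)
  -- The walk preserves the mean, so the adjoint bound may be applied to the image of `f`.
  have hg0 : ∑ b ∈ B, rightWeight A w b * g b = 0 := by
    rw [← hf, Finset.sum_congr rfl fun b hb => rightWeight_mul_walkOp hw f hb, Finset.sum_comm]
    refine Finset.sum_congr rfl fun a _ => ?_
    rw [leftWeight, Finset.sum_mul]
  -- Adjointness: the squared norm of `Af` is the inner product of `f` with `A*Af`.
  have hNeq : N = ∑ a ∈ A, f a * ∑ b ∈ B, w a b * g b := by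
    have : N = ∑ b ∈ B, ∑ a ∈ A, f a * (w a b * g b) := by
      refine Finset.sum_congr rfl fun b hb => ?_
      rw [sq, ← mul_assoc, rightWeight_mul_walkOp hw f hb, Finset.sum_mul]
      exact Finset.sum_congr rfl fun a _ => by ring
    rw [this, Finset.sum_comm]
    simp_rw [Finset.mul_sum]
  have hcs : N ^ 2 ≤ F * ∑ a ∈ A, (∑ b ∈ B, w a b * g b) ^ 2 / leftWeight B w a := by
    rw [hNeq]
    refine sum_mul_sq_le A _ f _ (fun a ha => leftWeight_nonneg hw ha) fun a ha h0 => ?_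
    have h0' := (Finset.sum_eq_zero_iff_of_nonneg fun b hb => hw a ha b hb).1 h0
    exact Finset.sum_eq_zero fun b hb => by rw [h0' b hb, zero_mul]
  have h2 : N ^ 2 ≤ F * (c * N) := hcs.trans (mul_le_mul_of_nonneg_left (h g hg0) hF0)
  by_contra! hlt
  have hpos : 0 < N := (mul_nonneg hc hF0).trans_lt hlt
  nlinarith

theorem lambda_nonneg (A : Finset U) (B : Finset V) (w : U → V → ℝ) : 0 ≤ lambda A B w := by
  refine Real.sSup_nonneg ?_
  rintro r ⟨f, -, -, rfl⟩
  positivity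

theorem lambda_sq_le {A : Finset U} {B : Finset V} {w : U → V → ℝ} {c : ℝ}
    (hw : ∀ a ∈ A, ∀ b ∈ B, 0 ≤ w a b) (hc : 0 ≤ c) (h : AvgBound A B w c) :
    lambda A B w ^ 2 ≤ c := by
  refine (Real.le_sqrt (lambda_nonneg A B w) hc).1 (Real.sSup_le ?_ (Real.sqrt_nonneg _))
  rintro r ⟨f, hpos, hf, rfl⟩
  rw [← Real.sqrt_div' _ hpos.le]
  exact Real.sqrt_le_sqrt ((div_le_iff₀ hpos).2 (h.walkOp_le hw hc f hf))

/-- Averaging is a contraction. -/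
theorem walkOp_contraction {A : Finset U} {B : Finset V} {w : U → V → ℝ}
    (hw : ∀ a ∈ A, ∀ b ∈ B, 0 ≤ w a b) (f : U → ℝ) :
    ∑ b ∈ B, rightWeight A w b * walkOp A w f b ^ 2 ≤ ∑ a ∈ A, leftWeight B w a * f a ^ 2 := by
  have : ∑ a ∈ A, leftWeight B w a * f a ^ 2 = ∑ b ∈ B, ∑ a ∈ A, w a b * f a ^ 2 := by
    rw [Finset.sum_comm]
    exact Finset.sum_congr rfl fun a _ => by rw [leftWeight, Finset.sum_mul]
  rw [this]
  refine Finset.sum_le_sum fun b hb => ?_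
  have hcs : (∑ a ∈ A, w a b * f a) ^ 2 ≤ rightWeight A w b * ∑ a ∈ A, w a b * f a ^ 2 :=
    Finset.sum_sq_le_sum_mul_sum_of_sq_le_mul A (fun a ha => hw a ha b hb)
      (fun a ha => mul_nonneg (hw a ha b hb) (sq_nonneg _)) fun a _ => le_of_eq (by ring)
  rcases (rightWeight_nonneg hw hb).eq_or_lt with h0 | hpos
  · rw [← h0, zero_mul]
    exact Finset.sum_nonneg fun a ha => mul_nonneg (hw a ha b hb) (sq_nonneg _)
  · unfold walkOp
    rw [div_pow, sq (rightWeight A w b), mul_div_assoc', mul_div_mul_left _ _ hpos.ne',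
      div_le_iff₀ hpos]
    linarith

/-- The spectral gap of a graph bounds its quadratic form on functions orthogonal to constants. -/
theorem quadForm_le_of_orthogonal {A : Finset U} {w : U → U → ℝ} {γ : ℝ}
    (hw : ∀ a ∈ A, ∀ b ∈ A, 0 ≤ w a b) (hsymm : ∀ a b, w a b = w b a) (hγ : lambda A A w ≤ γ)
    (f : U → ℝ) (hf : ∑ a ∈ A, leftWeight A w a * f a = 0) :
    ∑ a ∈ A, ∑ b ∈ A, w a b * f a * f b ≤ γ * ∑ a ∈ A, leftWeight A w a * f a ^ 2 := by
  have hlr : ∀ b, rightWeight A w b = leftWeight A w b := fun b =>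
    Finset.sum_congr rfl fun a _ => hsymm a b
  set F := ∑ a ∈ A, leftWeight A w a * f a ^ 2 with hF
  have hF0 : 0 ≤ F :=
    Finset.sum_nonneg fun a ha => mul_nonneg (leftWeight_nonneg hw ha) (sq_nonneg _)
  set N := ∑ b ∈ A, rightWeight A w b * walkOp A w f b ^ 2 with hN
  have hN0 : 0 ≤ N :=
    Finset.sum_nonneg fun b hb => mul_nonneg (rightWeight_nonneg hw hb) (sq_nonneg _)
  have hquad : ∑ a ∈ A, ∑ b ∈ A, w a b * f a * f b
      = ∑ b ∈ A, f b * (rightWeight A w b * walkOp A w f b) := by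
    rw [Finset.sum_comm]
    refine Finset.sum_congr rfl fun b hb => ?_
    rw [rightWeight_mul_walkOp hw f hb, Finset.mul_sum]
    exact Finset.sum_congr rfl fun a _ => by ring
  have hcs : (∑ a ∈ A, ∑ b ∈ A, w a b * f a * f b) ^ 2 ≤ F * N := by
    rw [hquad]
    refine Finset.sum_sq_le_sum_mul_sum_of_sq_le_mul A
      (fun a ha => mul_nonneg (leftWeight_nonneg hw ha) (sq_nonneg _))
      (fun b hb => mul_nonneg (rightWeight_nonneg hw hb) (sq_nonneg _)) fun b _ => le_of_eq ?_
    rw [hlr]; ring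
  rcases hF0.eq_or_lt with h0 | hpos
  · rw [← h0, zero_mul] at hcs
    rw [← h0, mul_zero, pow_eq_zero_iff two_ne_zero |>.1 (le_antisymm hcs (sq_nonneg _))]
  -- A real supremum dominates its members only when the set is bounded above; contraction supplies
  -- the bound `1`.
  have hle : √N / √F ≤ lambda A A w := by
    refine le_csSup ⟨1, ?_⟩ ⟨f, hpos, hf, rfl⟩
    rintro r ⟨f', hpos', -, rfl⟩
    exact div_le_one_of_le₀ (Real.sqrt_le_sqrt (walkOp_contraction hw f')) (Real.sqrt_nonneg _)
  have hsq : √N ≤ γ * √F := (div_le_iff₀ (Real.sqrt_pos.2 hpos)).1 (hle.trans hγ)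
  calc ∑ a ∈ A, ∑ b ∈ A, w a b * f a * f b ≤ √(F * N) := Real.le_sqrt_of_sq_le hcs
    _ = √F * √N := Real.sqrt_mul hF0 _
    _ ≤ √F * (γ * √F) := mul_le_mul_of_nonneg_left hsq (Real.sqrt_nonneg _)
    _ = γ * (√F * √F) := by ring
    _ = γ * F := by rw [Real.mul_self_sqrt hF0]

/-- Subtract the weighted mean `μ`. Constants are fixed by the walk, so the form splits into the
form of `f - μ` and `μ ^ 2` times the total weight, and the orthogonal case bounds the former. The
variance is then enlarged to the full second moment, which uses `0 ≤ γ`. -/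
theorem quadForm_le {A : Finset U} {w : U → U → ℝ} {γ : ℝ}
    (hw : ∀ a ∈ A, ∀ b ∈ A, 0 ≤ w a b) (hsymm : ∀ a b, w a b = w b a) (hγ : lambda A A w ≤ γ)
    (f : U → ℝ) :
    ∑ a ∈ A, ∑ b ∈ A, w a b * f a * f b ≤
      (∑ a ∈ A, leftWeight A w a * f a) ^ 2 / (∑ a ∈ A, leftWeight A w a) +
        γ * ∑ a ∈ A, leftWeight A w a * f a ^ 2 := by
  have hl : ∀ a ∈ A, 0 ≤ leftWeight A w a := fun a ha => leftWeight_nonneg hw ha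
  have hγ0 : 0 ≤ γ := (lambda_nonneg A A w).trans hγ
  set W := ∑ a ∈ A, leftWeight A w a with hW
  set M := ∑ a ∈ A, leftWeight A w a * f a with hM
  set F := ∑ a ∈ A, leftWeight A w a * f a ^ 2 with hF
  have hF0 : 0 ≤ F := Finset.sum_nonneg fun a ha => mul_nonneg (hl a ha) (sq_nonneg _)
  rcases (Finset.sum_nonneg hl).eq_or_lt with h0 | hpos
  · have hz := (Finset.sum_eq_zero_iff_of_nonneg hl).1 h0.symm
    have : ∑ a ∈ A, ∑ b ∈ A, w a b * f a * f b = 0 := by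
      refine Finset.sum_eq_zero fun a ha => Finset.sum_eq_zero fun b hb => ?_
      rw [(Finset.sum_eq_zero_iff_of_nonneg fun b hb => hw a ha b hb).1 (hz a ha) b hb]
      ring
    rw [this, hW, ← h0, div_zero]
    positivity
  have hpos : 0 < W := hpos
  set μ := M / W with hμ
  have hMW : M = μ * W := by rw [hμ]; field_simp
  have hcomm : ∑ a ∈ A, ∑ b ∈ A, w a b * f b = M := by
    rw [Finset.sum_comm]
    refine Finset.sum_congr rfl fun b _ => ?_
    rw [leftWeight, Finset.sum_mul]
    exact Finset.sum_congr rfl fun a _ => by rw [hsymm]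
  have hcomm' : ∑ a ∈ A, ∑ b ∈ A, w a b * f a = M :=
    Finset.sum_congr rfl fun a _ => by rw [leftWeight, Finset.sum_mul]
  have key := quadForm_le_of_orthogonal hw hsymm hγ (fun a => f a - μ) (by
    simp_rw [mul_sub, Finset.sum_sub_distrib, ← Finset.sum_mul]
    rw [← hM, ← hW, hMW]; ring)
  have e1 : ∑ a ∈ A, ∑ b ∈ A, w a b * (f a - μ) * (f b - μ)
      = ∑ a ∈ A, ∑ b ∈ A, w a b * f a * f b - μ * M - μ * M + μ ^ 2 * W := by
    have : ∀ a b, w a b * (f a - μ) * (f b - μ)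
        = w a b * f a * f b - μ * (w a b * f b) - μ * (w a b * f a) + μ ^ 2 * w a b := by
      intros; ring
    simp_rw [this, Finset.sum_add_distrib, Finset.sum_sub_distrib, ← Finset.mul_sum]
    rw [hcomm, hcomm']
    rfl
  have e2 : ∑ a ∈ A, leftWeight A w a * (f a - μ) ^ 2 = F - 2 * μ * M + μ ^ 2 * W := by
    have : ∀ a, leftWeight A w a * (f a - μ) ^ 2
        = leftWeight A w a * f a ^ 2 - 2 * μ * (leftWeight A w a * f a)
          + μ ^ 2 * leftWeight A w a := by
      intros; ring
    simp_rw [this, Finset.sum_add_distrib, Finset.sum_sub_distrib, ← Finset.mul_sum]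
    rfl
  rw [e1, e2] at key
  have e3 : M ^ 2 / W = μ * M := by rw [hμ]; ring
  have e4 : μ ^ 2 * W = μ * M := by rw [hMW]; ring
  have e5 : 0 ≤ μ * M := by rw [← e3]; positivity
  rw [e3]
  rw [e4] at key
  nlinarith [mul_nonneg hγ0 e5]

end Bipartite

/-! ### Face probabilities and double counting. -/

theorem PureComplex.mem_layer {V : Type u} {d : ℕ} {X : PureComplex V d} {m : ℕ} {s : Finset V} :
    s ∈ X.layer m ↔ s ∈ X.faces ∧ s.card = m := by
  simp [PureComplex.layer]

theorem PureComplex.empty_mem_faces {V : Type u} {d : ℕ} (X : PureComplex V d) : ∅ ∈ X.faces := by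
  obtain ⟨s, hs⟩ := X.nonempty
  exact X.down_closed s hs _ (Finset.empty_subset s)

namespace WeightedComplex

variable {V : Type u} [DecidableEq V] {d : ℕ} (X : WeightedComplex V d)

theorem mem_verts_of_mem {s : Finset V} (hs : s ∈ X.faces) {x : V} (hx : x ∈ s) : x ∈ X.verts :=
  Finset.mem_biUnion.2 ⟨s, hs, hx⟩

theorem mem_verts {x : V} : x ∈ X.verts ↔ {x} ∈ X.faces := by
  constructor
  · intro h
    obtain ⟨s, hs, hx⟩ := Finset.mem_biUnion.1 h
    exact X.down_closed s hs _ (Finset.singleton_subset_iff.2 hx)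
  · exact fun h => X.mem_verts_of_mem h (Finset.mem_singleton_self x)

theorem faceProb_nonneg (s : Finset V) : 0 ≤ X.faceProb s :=
  Finset.sum_nonneg fun t ht =>
    div_nonneg (X.prob_pos t (Finset.mem_filter.1 ht).1).le (Nat.cast_nonneg _)

theorem faceProb_eq_zero {s : Finset V} (hs : s ∉ X.faces) : X.faceProb s = 0 := by
  refine Finset.sum_eq_zero fun t ht => absurd ?_ hs
  obtain ⟨ht, hst⟩ := Finset.mem_filter.1 ht
  exact X.down_closed t (PureComplex.mem_layer.1 ht).1 s hst

theorem faceProb_pos {s : Finset V} (hs : s ∈ X.faces) : 0 < X.faceProb s := by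
  obtain ⟨t, ht, hst, hc⟩ := X.pure s hs
  refine Finset.sum_pos (fun t ht => div_pos (X.prob_pos t (Finset.mem_filter.1 ht).1) ?_)
    ⟨t, Finset.mem_filter.2 ⟨PureComplex.mem_layer.2 ⟨ht, hc⟩, hst⟩⟩
  exact_mod_cast Nat.choose_pos (X.card_le s hs)

theorem faceProb_empty : X.faceProb ∅ = 1 := by
  simp [faceProb, X.prob_sum]

/-- Double counting of the pairs of a face and a subset of it. -/
theorem sum_layer_powersetCard {i j : ℕ} (F : Finset V → Finset V → ℝ) :
    ∑ T ∈ X.layer j, ∑ S ∈ T.powersetCard i, F T S =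
      ∑ S ∈ X.layer i, ∑ T ∈ (X.layer j).filter (fun T => S ⊆ T), F T S := by
  refine Finset.sum_comm' fun T S => ?_
  simp only [PureComplex.mem_layer, Finset.mem_powersetCard, Finset.mem_filter]
  constructor
  · rintro ⟨⟨hT, hj⟩, hST, hi⟩
    exact ⟨⟨⟨hT, hj⟩, hST⟩, X.down_closed T hT S hST, hi⟩
  · rintro ⟨⟨⟨hT, hj⟩, hST⟩, -, hi⟩
    exact ⟨⟨hT, hj⟩, hST, hi⟩

/-- Exchange the sums: a top face `t` containing `s` is counted once for each intermediate `T`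
between `s` and `t`, and the binomial coefficient is the number of these. -/
theorem sum_prob_mul_choose {s : Finset V} {m : ℕ} (hsm : s.card ≤ m)
    (F : Finset V → ℝ) :
    ∑ T ∈ (X.layer m).filter (fun T => s ⊆ T),
        ∑ t ∈ (X.layer (d + 1)).filter (fun t => T ⊆ t), F t =
      ((d + 1 - s.card).choose (m - s.card) : ℝ) *
        ∑ t ∈ (X.layer (d + 1)).filter (fun t => s ⊆ t), F t := by
  have : ∑ T ∈ (X.layer m).filter (fun T => s ⊆ T),
        ∑ t ∈ (X.layer (d + 1)).filter (fun t => T ⊆ t), F t =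
      ∑ t ∈ (X.layer (d + 1)).filter (fun t => s ⊆ t),
        ∑ T ∈ (t.powersetCard m).filter (fun T => s ⊆ T), F t := by
    refine Finset.sum_comm' fun T t => ?_
    simp only [PureComplex.mem_layer, Finset.mem_powersetCard, Finset.mem_filter]
    constructor
    · rintro ⟨⟨⟨hT, hm⟩, hsT⟩, ht, hTt⟩
      exact ⟨⟨⟨hTt, hm⟩, hsT⟩, ht, hsT.trans hTt⟩
    · rintro ⟨⟨⟨hTt, hm⟩, hsT⟩, ht, hst⟩
      exact ⟨⟨⟨X.down_closed t ht.1 T hTt, hm⟩, hsT⟩, ht, hTt⟩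
  rw [this, Finset.mul_sum]
  refine Finset.sum_congr rfl fun t ht => ?_
  obtain ⟨ht, hst⟩ := Finset.mem_filter.1 ht
  rw [Finset.sum_const, Finset.card_filter_powersetCard_subset s t m hst hsm,
    (PureComplex.mem_layer.1 ht).2, nsmul_eq_mul]

/-- A face of `m` elements containing `s` has `m.choose s.card` faces of the size of `s`. -/
theorem sum_faceProb_superset {s : Finset V} {m : ℕ} (hsm : s.card ≤ m) (hm : m ≤ d + 1) :
    ∑ T ∈ (X.layer m).filter (fun T => s ⊆ T), X.faceProb T =
      (m.choose s.card : ℝ) * X.faceProb s := by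
  have h1 : ∑ T ∈ (X.layer m).filter (fun T => s ⊆ T), X.faceProb T =
      ∑ T ∈ (X.layer m).filter (fun T => s ⊆ T),
        ∑ t ∈ (X.layer (d + 1)).filter (fun t => T ⊆ t), X.prob t / ((d + 1).choose m : ℝ) := by
    refine Finset.sum_congr rfl fun T hT => ?_
    rw [faceProb, (PureComplex.mem_layer.1 (Finset.mem_filter.1 hT).1).2]
  have hc1 : ((d + 1).choose m : ℝ) ≠ 0 := by exact_mod_cast (Nat.choose_pos hm).ne'
  have hc2 : ((d + 1).choose s.card : ℝ) ≠ 0 := by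
    exact_mod_cast (Nat.choose_pos (hsm.trans hm)).ne'
  have hch : ((d + 1).choose m : ℝ) * (m.choose s.card : ℝ) =
      ((d + 1).choose s.card : ℝ) * ((d + 1 - s.card).choose (m - s.card) : ℝ) := by
    exact_mod_cast Nat.choose_mul hsm
  rw [h1, X.sum_prob_mul_choose hsm, faceProb, ← Finset.sum_div, ← Finset.sum_div]
  field_simp
  rw [mul_assoc _ ((d + 1).choose m : ℝ), hch]
  ring

theorem sum_faceProb_mul_powersetCard {i j : ℕ} (hij : i ≤ j) (hj : j ≤ d + 1)
    (g : Finset V → ℝ) :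
    ∑ T ∈ X.layer j, X.faceProb T * ∑ S ∈ T.powersetCard i, g S =
      (j.choose i : ℝ) * ∑ S ∈ X.layer i, X.faceProb S * g S := by
  simp_rw [Finset.mul_sum]
  rw [X.sum_layer_powersetCard fun T S => X.faceProb T * g S]
  refine Finset.sum_congr rfl fun S hS => ?_
  have hc := (PureComplex.mem_layer.1 hS).2
  rw [← Finset.sum_mul, X.sum_faceProb_superset (hc.le.trans hij) hj, hc]
  ring

theorem sum_faceProb_layer {m : ℕ} (hm : m ≤ d + 1) : ∑ T ∈ X.layer m, X.faceProb T = 1 := by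
  have := X.sum_faceProb_superset (s := ∅) (m := m) (by simp) hm
  simpa [X.faceProb_empty] using this

theorem mem_linkVerts {s : Finset V} {x : V} :
    x ∈ X.linkVerts s ↔ x ∉ s ∧ insert x s ∈ X.faces := by
  unfold linkVerts
  rw [Finset.mem_filter, and_iff_right_iff_imp]
  exact fun h => X.mem_verts_of_mem h.2 (Finset.mem_insert_self x s)

/-- The faces with one more element than `s` that contain `s` are indexed by the link. -/
theorem sum_linkVerts {s : Finset V} (F : Finset V → ℝ) :
    ∑ x ∈ X.linkVerts s, F (insert x s) =
      ∑ T ∈ (X.layer (s.card + 1)).filter (fun T => s ⊆ T), F T := by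
  refine Finset.sum_nbij (fun x => insert x s) ?_ ?_ ?_ fun _ _ => rfl
  · intro x hx
    obtain ⟨h1, h2⟩ := X.mem_linkVerts.1 hx
    exact Finset.mem_filter.2 ⟨PureComplex.mem_layer.2 ⟨h2, Finset.card_insert_of_notMem h1⟩,
      Finset.subset_insert x s⟩
  · intro x hx y hy hxy
    have hx' := (X.mem_linkVerts.1 hx).1
    have : x ∈ insert y s := by
      have h : insert x s = insert y s := hxy
      rw [← h]; exact Finset.mem_insert_self x s
    exact (Finset.mem_insert.1 this).resolve_right hx'
  · intro T hT
    obtain ⟨hT, hsT⟩ := Finset.mem_filter.1 hT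
    obtain ⟨hT, hc⟩ := PureComplex.mem_layer.1 hT
    obtain ⟨x, hx⟩ := Finset.card_eq_one.1
      (show (T \ s).card = 1 by rw [Finset.card_sdiff_of_subset hsT, hc]; omega)
    have hxT : x ∈ T \ s := by rw [hx]; exact Finset.mem_singleton_self x
    have hins : insert x s = T := by
      rw [Finset.insert_eq, ← hx, Finset.sdiff_union_of_subset hsT]
    exact ⟨x, X.mem_linkVerts.2 ⟨(Finset.mem_sdiff.1 hxT).2, hins ▸ hT⟩, hins⟩

theorem sum_faceProb_insert {s : Finset V} (hs : s.card ≤ d) :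
    ∑ x ∈ X.linkVerts s, X.faceProb (insert x s) = (s.card + 1 : ℝ) * X.faceProb s := by
  rw [X.sum_linkVerts X.faceProb, X.sum_faceProb_superset (Nat.le_succ _) (by omega)]
  norm_num

end WeightedComplex

/-! ### Averaging over subsets, as an operator between layers. -/

/-- The average of `g` over the `i`-element subsets of `T`. -/
noncomputable def subsetAvg {V : Type u} (i : ℕ) (g : Finset V → ℝ) (T : Finset V) : ℝ :=
  (∑ S ∈ T.powersetCard i, g S) / (T.card.choose i : ℝ)

/-- A uniform `i`-subset of a uniform `j`-subset of `T` is a uniform `i`-subset of `T`. This is what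
lets bounds between layers be composed. -/
theorem subsetAvg_subsetAvg {V : Type u} [DecidableEq V] {i j : ℕ} (hij : i ≤ j)
    (g : Finset V → ℝ) {T : Finset V} (hT : j ≤ T.card) :
    subsetAvg j (subsetAvg i g) T = subsetAvg i g T := by
  have h1 : ∑ S ∈ T.powersetCard j, subsetAvg i g S =
      (∑ S ∈ T.powersetCard j, ∑ R ∈ S.powersetCard i, g R) / (j.choose i : ℝ) := by
    rw [Finset.sum_div]
    refine Finset.sum_congr rfl fun S hS => ?_
    rw [subsetAvg, (Finset.mem_powersetCard.1 hS).2]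
  have h2 : ∑ S ∈ T.powersetCard j, ∑ R ∈ S.powersetCard i, g R =
      ∑ R ∈ T.powersetCard i, ∑ S ∈ (T.powersetCard j).filter (fun S => R ⊆ S), g R := by
    refine Finset.sum_comm' fun S R => ?_
    simp only [Finset.mem_powersetCard, Finset.mem_filter]
    constructor
    · rintro ⟨⟨hS, hj⟩, hRS, hi⟩
      exact ⟨⟨⟨hS, hj⟩, hRS⟩, hRS.trans hS, hi⟩
    · rintro ⟨⟨⟨hS, hj⟩, hRS⟩, -, hi⟩
      exact ⟨⟨hS, hj⟩, hRS, hi⟩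
  have h3 : ∑ R ∈ T.powersetCard i, ∑ S ∈ (T.powersetCard j).filter (fun S => R ⊆ S), g R =
      ((T.card - i).choose (j - i) : ℝ) * ∑ R ∈ T.powersetCard i, g R := by
    rw [Finset.mul_sum]
    refine Finset.sum_congr rfl fun R hR => ?_
    obtain ⟨hRT, hc⟩ := Finset.mem_powersetCard.1 hR
    rw [Finset.sum_const, Finset.card_filter_powersetCard_subset R T j hRT (hc.le.trans hij), hc,
      nsmul_eq_mul]
  have hc1 : (0 : ℝ) < (j.choose i : ℝ) := by exact_mod_cast Nat.choose_pos hij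
  have hc2 : (0 : ℝ) < (T.card.choose j : ℝ) := by exact_mod_cast Nat.choose_pos hT
  have hc3 : (0 : ℝ) < (T.card.choose i : ℝ) := by exact_mod_cast Nat.choose_pos (hij.trans hT)
  have hch : (T.card.choose j : ℝ) * (j.choose i : ℝ) =
      (T.card.choose i : ℝ) * ((T.card - i).choose (j - i) : ℝ) := by
    exact_mod_cast Nat.choose_mul hij
  rw [subsetAvg, subsetAvg, h1, h2, h3]
  field_simp
  rw [mul_assoc _ (j.choose i : ℝ), mul_comm (j.choose i : ℝ), hch]
  ring

namespace WeightedComplex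

variable {V : Type u} [DecidableEq V] {d : ℕ} (X : WeightedComplex V d)

/-- Averaging over `i`-element subsets contracts, by the factor `c`, the squared norm of the
functions of mean zero on the faces with `i` elements, as functions on those with `j` elements. -/
def UpBound (i j : ℕ) (c : ℝ) : Prop :=
  ∀ g : Finset V → ℝ, ∑ S ∈ X.layer i, X.faceProb S * g S = 0 →
    ∑ T ∈ X.layer j, X.faceProb T * subsetAvg i g T ^ 2 ≤
      c * ∑ S ∈ X.layer i, X.faceProb S * g S ^ 2

/-- The inclusion graph between faces, weighted by a multiple of the larger face. -/
noncomputable def inclWeight (κ : ℝ) (T S : Finset V) : ℝ := if S ⊆ T then X.faceProb T * κ else 0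

variable {X}

theorem inclWeight_nonneg {κ : ℝ} (hκ : 0 ≤ κ) (T S : Finset V) : 0 ≤ X.inclWeight κ T S := by
  unfold inclWeight
  split_ifs
  · exact mul_nonneg (X.faceProb_nonneg T) hκ
  · exact le_rfl

theorem filter_layer_subset {i j : ℕ} {T : Finset V} (hT : T ∈ X.layer j) :
    (X.layer i).filter (fun S => S ⊆ T) = T.powersetCard i := by
  ext S
  simp only [Finset.mem_filter, PureComplex.mem_layer, Finset.mem_powersetCard]
  constructor
  · rintro ⟨⟨-, h⟩, h'⟩
    exact ⟨h', h⟩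
  · rintro ⟨h', h⟩
    exact ⟨⟨X.down_closed T (PureComplex.mem_layer.1 hT).1 S h', h⟩, h'⟩

theorem sum_inclWeight_mul {i j : ℕ} {κ : ℝ} {T : Finset V} (hT : T ∈ X.layer j)
    (g : Finset V → ℝ) :
    ∑ S ∈ X.layer i, X.inclWeight κ T S * g S =
      X.faceProb T * κ * ∑ S ∈ T.powersetCard i, g S := by
  rw [← filter_layer_subset hT, Finset.sum_filter, Finset.mul_sum]
  refine Finset.sum_congr rfl fun S _ => ?_
  unfold inclWeight
  split_ifs <;> simp

theorem leftWeight_inclWeight {i j : ℕ} {κ : ℝ} {T : Finset V} (hT : T ∈ X.layer j) :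
    leftWeight (X.layer i) (X.inclWeight κ) T = X.faceProb T * κ * (j.choose i : ℝ) := by
  have := sum_inclWeight_mul (i := i) (κ := κ) hT fun _ => 1
  simp only [mul_one] at this
  rw [leftWeight, this, Finset.sum_const, Finset.card_powersetCard,
    (PureComplex.mem_layer.1 hT).2, nsmul_eq_mul, mul_one]

theorem rightWeight_inclWeight {i j : ℕ} (hij : i ≤ j) (hj : j ≤ d + 1) {κ : ℝ} {S : Finset V}
    (hS : S ∈ X.layer i) :
    rightWeight (X.layer j) (X.inclWeight κ) S = (j.choose i : ℝ) * κ * X.faceProb S := by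
  have hc := (PureComplex.mem_layer.1 hS).2
  unfold rightWeight inclWeight
  rw [← Finset.sum_filter, ← Finset.sum_mul, X.sum_faceProb_superset (hc.le.trans hij) hj, hc]
  ring

/-- Both vertex weights of the inclusion graph are face probabilities times the common factor
`j.choose i * κ`, which cancels from the inequality. The adjoint walk operator is `subsetAvg`. -/
theorem UpBound.avgBound {i j : ℕ} (hij : i ≤ j) (hj : j ≤ d + 1) {κ c : ℝ} (hκ : 0 < κ)
    (h : X.UpBound i j c) : AvgBound (X.layer j) (X.layer i) (X.inclWeight κ) c := by
  intro g hg
  have hch : (0 : ℝ) < (j.choose i : ℝ) := by exact_mod_cast Nat.choose_pos hij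
  have hr : ∀ F : Finset V → ℝ,
      ∑ S ∈ X.layer i, rightWeight (X.layer j) (X.inclWeight κ) S * F S =
        (j.choose i : ℝ) * κ * ∑ S ∈ X.layer i, X.faceProb S * F S := by
    intro F
    rw [Finset.mul_sum]
    refine Finset.sum_congr rfl fun S hS => ?_
    rw [rightWeight_inclWeight hij hj hS, mul_assoc]
  rw [hr] at hg ⊢
  have hg' := h g ((mul_eq_zero.1 hg).resolve_left (by positivity))
  have : ∑ T ∈ X.layer j, (∑ S ∈ X.layer i, X.inclWeight κ T S * g S) ^ 2 /
      leftWeight (X.layer i) (X.inclWeight κ) T =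
      (j.choose i : ℝ) * κ * ∑ T ∈ X.layer j, X.faceProb T * subsetAvg i g T ^ 2 := by
    rw [Finset.mul_sum]
    refine Finset.sum_congr rfl fun T hT => ?_
    have hP := X.faceProb_pos (PureComplex.mem_layer.1 hT).1
    rw [sum_inclWeight_mul hT, leftWeight_inclWeight hT, subsetAvg,
      (PureComplex.mem_layer.1 hT).2]
    field_simp
  rw [this]
  calc _ ≤ (j.choose i : ℝ) * κ * (c * ∑ S ∈ X.layer i, X.faceProb S * g S ^ 2) :=
        mul_le_mul_of_nonneg_left hg' (by positivity)
    _ = _ := by ring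

theorem sum_faceProb_mul_subsetAvg {i j : ℕ} (hij : i ≤ j) (hj : j ≤ d + 1)
    (g : Finset V → ℝ) :
    ∑ T ∈ X.layer j, X.faceProb T * subsetAvg i g T =
      ∑ S ∈ X.layer i, X.faceProb S * g S := by
  have hch : (0 : ℝ) < (j.choose i : ℝ) := by exact_mod_cast Nat.choose_pos hij
  have h := X.sum_faceProb_mul_powersetCard hij hj g
  have : ∑ T ∈ X.layer j, X.faceProb T * subsetAvg i g T =
      (∑ T ∈ X.layer j, X.faceProb T * ∑ S ∈ T.powersetCard i, g S) / (j.choose i : ℝ) := by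
    rw [Finset.sum_div]
    refine Finset.sum_congr rfl fun T hT => ?_
    rw [subsetAvg, (PureComplex.mem_layer.1 hT).2, mul_div_assoc]
  rw [this, h]
  field_simp

theorem UpBound.trans {i j l : ℕ} (hij : i ≤ j) (hjl : j ≤ l) (hl : l ≤ d + 1) {c e : ℝ}
    (he : 0 ≤ e) (h₁ : X.UpBound i j c) (h₂ : X.UpBound j l e) : X.UpBound i l (e * c) := by
  intro g hg
  have hz : ∑ S ∈ X.layer j, X.faceProb S * subsetAvg i g S = 0 := by
    rw [sum_faceProb_mul_subsetAvg hij (hjl.trans hl), hg]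
  have := h₂ _ hz
  have heq : ∑ T ∈ X.layer l, X.faceProb T * subsetAvg j (subsetAvg i g) T ^ 2 =
      ∑ T ∈ X.layer l, X.faceProb T * subsetAvg i g T ^ 2 := by
    refine Finset.sum_congr rfl fun T hT => ?_
    rw [subsetAvg_subsetAvg hij g (hjl.trans (PureComplex.mem_layer.1 hT).2.ge)]
  rw [heq] at this
  calc _ ≤ _ := this
    _ ≤ e * (c * _) := mul_le_mul_of_nonneg_left (h₁ g hg) he
    _ = _ := by ring

theorem UpBound.mono {i j : ℕ} {c e : ℝ} (hce : c ≤ e) (h : X.UpBound i j c) :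
    X.UpBound i j e := fun g hg =>
  (h g hg).trans (mul_le_mul_of_nonneg_right hce
    (Finset.sum_nonneg fun S _ => mul_nonneg (X.faceProb_nonneg S) (sq_nonneg _)))

/-- Jensen's inequality inside each face; the mean-zero condition plays no role. -/
theorem upBound_one {i j : ℕ} (hij : i ≤ j) (hj : j ≤ d + 1) : X.UpBound i j 1 := by
  intro g _
  rw [one_mul, ← sum_faceProb_mul_subsetAvg hij hj fun S => g S ^ 2]
  refine Finset.sum_le_sum fun T hT => mul_le_mul_of_nonneg_left ?_ (X.faceProb_nonneg T)
  have hcard := (PureComplex.mem_layer.1 hT).2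
  have hch : (0 : ℝ) < (T.card.choose i : ℝ) := by
    rw [hcard]; exact_mod_cast Nat.choose_pos hij
  have := sq_sum_le_card_mul_sum_sq (s := T.powersetCard i) (f := g)
  rw [Finset.card_powersetCard] at this
  unfold subsetAvg
  rw [div_pow, div_le_div_iff₀ (by positivity) hch]
  nlinarith

end WeightedComplex

/-! ### From spectral gaps of links to bounds between layers. -/

theorem sum_powersetCard_eq_sum_erase {V : Type u} [DecidableEq V] {k : ℕ} {T : Finset V}
    (hT : T.card = k + 1) (g : Finset V → ℝ) :
    ∑ S ∈ T.powersetCard k, g S = ∑ x ∈ T, g (T.erase x) := by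
  symm
  refine Finset.sum_nbij (fun x => T.erase x) ?_ ?_ ?_ fun _ _ => rfl
  · intro x hx
    refine Finset.mem_powersetCard.2 ⟨Finset.erase_subset x T, ?_⟩
    rw [Finset.card_erase_of_mem hx, hT]; rfl
  · exact Finset.erase_injOn T
  · intro S hS
    obtain ⟨hST, hc⟩ := Finset.mem_powersetCard.1 hS
    obtain ⟨x, hx⟩ := Finset.card_eq_one.1
      (show (T \ S).card = 1 by rw [Finset.card_sdiff_of_subset hST, hT, hc]; omega)
    have hxT : x ∈ T := (Finset.mem_sdiff.1 (hx ▸ Finset.mem_singleton_self x : x ∈ T \ S)).1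
    refine ⟨x, hxT, ?_⟩
    change T.erase x = S
    rw [Finset.erase_eq, ← hx, Finset.sdiff_sdiff_eq_self hST]

namespace WeightedComplex

variable {V : Type u} [DecidableEq V] {d : ℕ} {X : WeightedComplex V d}

/-- Sums over pairs of distinct facets of a face are sums over edges of the links. -/
theorem sum_layer_offDiag {k : ℕ} (F : Finset V → Finset V → Finset V → ℝ)
    (hF : ∀ T ∉ X.faces, ∀ S S', F T S S' = 0) :
    ∑ T ∈ X.layer (k + 2), ∑ z ∈ T.offDiag, F T (T.erase z.1) (T.erase z.2) =
      ∑ R ∈ X.layer k, ∑ x ∈ X.linkVerts R, ∑ y ∈ X.linkVerts R,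
        if x ≠ y then F (insert x (insert y R)) (insert x R) (insert y R) else 0 := by
  have hrhs : ∀ R, (∑ x ∈ X.linkVerts R, ∑ y ∈ X.linkVerts R,
        if x ≠ y then F (insert x (insert y R)) (insert x R) (insert y R) else 0) =
      ∑ z ∈ (X.linkVerts R ×ˢ X.linkVerts R).filter
          (fun z => z.1 ≠ z.2 ∧ insert z.1 (insert z.2 R) ∈ X.faces),
        F (insert z.1 (insert z.2 R)) (insert z.1 R) (insert z.2 R) := by
    intro R
    rw [← Finset.sum_product', Finset.sum_filter]
    refine Finset.sum_congr rfl fun z _ => ?_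
    by_cases h1 : z.1 ≠ z.2
    · by_cases h2 : insert z.1 (insert z.2 R) ∈ X.faces
      · simp [h1, h2]
      · simp [h1, h2, hF _ h2]
    · simp [h1]
  rw [Finset.sum_congr rfl fun R _ => hrhs R, Finset.sum_sigma', Finset.sum_sigma']
  -- The pair is swapped: with `R` equal to `T` without `x` and `y`, erasing `x` leaves `insert y
  -- R`.
  refine Finset.sum_bij' (fun p _ => ⟨(p.1.erase p.2.1).erase p.2.2, (p.2.2, p.2.1)⟩)
    (fun p _ => ⟨insert p.2.1 (insert p.2.2 p.1), (p.2.2, p.2.1)⟩) ?_ ?_ ?_ ?_ ?_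
  · rintro ⟨T, x, y⟩ h
    simp only [Finset.mem_sigma, PureComplex.mem_layer, Finset.mem_offDiag] at h
    obtain ⟨⟨hT, hc⟩, hx, hy, hxy⟩ := h
    have hy' : y ∈ T.erase x := Finset.mem_erase.2 ⟨fun h => hxy h.symm, hy⟩
    have hx' : x ∈ T.erase y := Finset.mem_erase.2 ⟨hxy, hx⟩
    simp only [Finset.mem_sigma, PureComplex.mem_layer, Finset.mem_filter, Finset.mem_product,
      mem_linkVerts]
    have e1 : insert y ((T.erase x).erase y) = T.erase x := Finset.insert_erase hy'
    have e2 : insert x ((T.erase x).erase y) = T.erase y := by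
      rw [Finset.erase_right_comm]; exact Finset.insert_erase hx'
    have hf : ∀ S ⊆ T, S ∈ X.faces := fun S h => X.down_closed T hT S h
    refine ⟨⟨hf _ ((Finset.erase_subset _ _).trans (Finset.erase_subset _ _)), ?_⟩,
      ⟨⟨by simp, ?_⟩, by simp, ?_⟩, fun h => hxy h.symm, ?_⟩
    · rw [Finset.card_erase_of_mem hy', Finset.card_erase_of_mem hx, hc]; rfl
    · rw [e1]; exact hf _ (Finset.erase_subset _ _)
    · rw [e2]; exact hf _ (Finset.erase_subset _ _)
    · rw [e2, Finset.insert_erase hy]; exact hT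
  · rintro ⟨R, x, y⟩ h
    simp only [Finset.mem_sigma, PureComplex.mem_layer, Finset.mem_filter, Finset.mem_product,
      mem_linkVerts] at h
    obtain ⟨⟨hR, hc⟩, ⟨⟨hx, -⟩, hy, -⟩, hxy, hf⟩ := h
    simp only [Finset.mem_sigma, PureComplex.mem_layer, Finset.mem_offDiag]
    have hx' : x ∉ insert y R := by simp [hx, hxy]
    refine ⟨⟨hf, ?_⟩, by simp, by simp, fun h => hxy h.symm⟩
    rw [Finset.card_insert_of_notMem hx', Finset.card_insert_of_notMem hy, hc]
  · rintro ⟨T, x, y⟩ h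
    simp only [Finset.mem_sigma, Finset.mem_offDiag] at h
    obtain ⟨-, hx, hy, hxy⟩ := h
    have hx' : x ∈ T.erase y := Finset.mem_erase.2 ⟨hxy, hx⟩
    simp only [Sigma.mk.injEq, heq_eq_eq, and_true]
    rw [Finset.erase_right_comm, Finset.insert_erase hx', Finset.insert_erase hy]
  · rintro ⟨R, x, y⟩ h
    simp only [Finset.mem_sigma, Finset.mem_filter, Finset.mem_product, mem_linkVerts] at h
    obtain ⟨-, ⟨⟨hx, -⟩, hy, -⟩, hxy, -⟩ := h
    simp only [Sigma.mk.injEq, heq_eq_eq, and_true]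
    rw [Finset.insert_comm, Finset.erase_insert (by simp [hy, Ne.symm hxy]),
      Finset.erase_insert hx]
  · rintro ⟨T, x, y⟩ h
    simp only [Finset.mem_sigma, Finset.mem_offDiag] at h
    obtain ⟨-, hx, hy, hxy⟩ := h
    have hy' : y ∈ T.erase x := Finset.mem_erase.2 ⟨fun h => hxy h.symm, hy⟩
    have hx' : x ∈ T.erase y := Finset.mem_erase.2 ⟨hxy, hx⟩
    have e1 : insert y ((T.erase x).erase y) = T.erase x := Finset.insert_erase hy'
    have e2 : insert x ((T.erase x).erase y) = T.erase y := by
      rw [Finset.erase_right_comm]; exact Finset.insert_erase hx'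
    simp only
    rw [e1, e2, Finset.insert_erase hy]

theorem linkWeight_nonneg (s : Finset V) (x y : V) : 0 ≤ X.linkWeight s x y := by
  unfold linkWeight
  split_ifs
  · exact div_nonneg (X.faceProb_nonneg _) (Finset.sum_nonneg fun t _ => X.faceProb_nonneg t)
  · exact le_rfl

theorem linkWeight_symm (s : Finset V) (x y : V) : X.linkWeight s x y = X.linkWeight s y x := by
  unfold linkWeight
  rw [Finset.insert_comm x y]
  congr 1
  rw [ne_comm, and_comm (a := x ∉ s)]

/-- The normalization of the edge weights of the link of a face. -/
noncomputable def linkMass (X : WeightedComplex V d) (s : Finset V) : ℝ :=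
  ∑ t ∈ (X.layer (s.card + 2)).filter (fun t => s ⊆ t), X.faceProb t

theorem linkMass_eq {s : Finset V} (hs : s.card < d) :
    X.linkMass s = ((s.card + 2).choose s.card : ℝ) * X.faceProb s :=
  X.sum_faceProb_superset (by omega) (by omega)

theorem linkMass_pos {s : Finset V} (hs : s ∈ X.faces) (hd : s.card < d) : 0 < X.linkMass s := by
  rw [linkMass_eq hd]
  have : 0 < (s.card + 2).choose s.card := Nat.choose_pos (by omega)
  have := X.faceProb_pos hs
  positivity

/-- Multiplying by the conditioning probability removes the denominators, so that sums over
different links can be added. -/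
theorem linkMass_mul_linkWeight {s : Finset V} (hs : s ∈ X.faces) (hd : s.card < d) {x y : V}
    (hx : x ∈ X.linkVerts s) (hy : y ∈ X.linkVerts s) :
    X.linkMass s * X.linkWeight s x y =
      if x ≠ y then X.faceProb (insert x (insert y s)) else 0 := by
  have hx' := (X.mem_linkVerts.1 hx).1
  have hy' := (X.mem_linkVerts.1 hy).1
  have := (linkMass_pos hs hd).ne'
  unfold linkWeight
  by_cases hxy : x = y
  · simp [hxy]
  · rw [if_pos ⟨hxy, hx', hy'⟩, if_pos hxy]
    exact mul_div_cancel₀ _ this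

/-- The neighbours of `x` in the link of `s` that carry weight are exactly the link vertices of
`insert x s`; the other terms are probabilities of non-faces, hence zero. What remains is a sum over
the one-point extensions of `insert x s`. -/
theorem linkMass_mul_leftWeight {s : Finset V} (hs : s ∈ X.faces) (hd : s.card < d) {x : V}
    (hx : x ∈ X.linkVerts s) :
    X.linkMass s * leftWeight (X.linkVerts s) (X.linkWeight s) x =
      (s.card + 2 : ℝ) * X.faceProb (insert x s) := by
  obtain ⟨hx', hxs⟩ := X.mem_linkVerts.1 hx
  have hcard : (insert x s).card = s.card + 1 := Finset.card_insert_of_notMem hx'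
  have h := X.sum_faceProb_insert (s := insert x s) (by omega)
  rw [hcard] at h
  rw [leftWeight, Finset.mul_sum,
    Finset.sum_congr rfl fun y hy => linkMass_mul_linkWeight hs hd hx hy, ← Finset.sum_filter]
  have h2 : (s.card + 2 : ℝ) * X.faceProb (insert x s) =
      ∑ y ∈ X.linkVerts (insert x s), X.faceProb (insert y (insert x s)) := by
    rw [h]; push_cast; ring
  rw [h2]
  symm
  refine Finset.sum_subset_zero_on_sdiff ?_ ?_ fun y _ => by rw [Finset.insert_comm]
  · intro y hy
    obtain ⟨h1, h2⟩ := X.mem_linkVerts.1 hy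
    rw [Finset.mem_insert, not_or] at h1
    refine Finset.mem_filter.2 ⟨X.mem_linkVerts.2 ⟨h1.2, ?_⟩, fun h => h1.1 h.symm⟩
    exact X.down_closed _ h2 _ (Finset.insert_subset_insert y (Finset.subset_insert x s))
  · intro y hy
    rw [Finset.mem_sdiff, Finset.mem_filter, mem_linkVerts, mem_linkVerts] at hy
    obtain ⟨⟨⟨h1, -⟩, h2⟩, h3⟩ := hy
    refine X.faceProb_eq_zero fun h4 => h3 ⟨?_, by rwa [Finset.insert_comm]⟩
    rw [Finset.mem_insert, not_or]
    exact ⟨Ne.symm h2, h1⟩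

/-- The spectral gap of a link, in terms of the face probabilities. -/
theorem IsTwoSidedExpander.link_quadForm_le {γ : ℝ} (hX : X.IsTwoSidedExpander γ) {s : Finset V}
    (hs : s ∈ X.faces) (hd : s.card < d) (f : V → ℝ) :
    ∑ x ∈ X.linkVerts s, ∑ y ∈ X.linkVerts s,
        (if x ≠ y then X.faceProb (insert x (insert y s)) * f x * f y else 0) ≤
      (s.card + 2 : ℝ) / (s.card + 1) *
          ((∑ x ∈ X.linkVerts s, X.faceProb (insert x s) * f x) ^ 2 / X.faceProb s) +
        γ * ((s.card + 2) * ∑ x ∈ X.linkVerts s, X.faceProb (insert x s) * f x ^ 2) := by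
  have hZ := linkMass_pos hs hd
  have hP := X.faceProb_pos hs
  have key := mul_le_mul_of_nonneg_left (quadForm_le (A := X.linkVerts s) (w := X.linkWeight s)
    (fun a _ b _ => linkWeight_nonneg s a b) (linkWeight_symm s) (hX s hs hd) f) hZ.le
  have hl : ∀ F : V → ℝ, X.linkMass s *
      ∑ x ∈ X.linkVerts s, leftWeight (X.linkVerts s) (X.linkWeight s) x * F x =
        (s.card + 2 : ℝ) * ∑ x ∈ X.linkVerts s, X.faceProb (insert x s) * F x := by
    intro F
    rw [Finset.mul_sum, Finset.mul_sum]
    refine Finset.sum_congr rfl fun x hx => ?_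
    rw [← mul_assoc, linkMass_mul_leftWeight hs hd hx, mul_assoc]
  have e0 : X.linkMass s * ∑ x ∈ X.linkVerts s, leftWeight (X.linkVerts s) (X.linkWeight s) x =
      (s.card + 2 : ℝ) * ((s.card + 1) * X.faceProb s) := by
    have := hl fun _ => 1
    simp only [mul_one] at this
    rw [this, X.sum_faceProb_insert hd.le]
  have e1 : X.linkMass s * ∑ a ∈ X.linkVerts s, ∑ b ∈ X.linkVerts s,
      X.linkWeight s a b * f a * f b = ∑ x ∈ X.linkVerts s, ∑ y ∈ X.linkVerts s,
        (if x ≠ y then X.faceProb (insert x (insert y s)) * f x * f y else 0) := by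
    rw [Finset.mul_sum]
    refine Finset.sum_congr rfl fun x hx => ?_
    rw [Finset.mul_sum]
    refine Finset.sum_congr rfl fun y hy => ?_
    rw [← mul_assoc, ← mul_assoc, linkMass_mul_linkWeight hs hd hx hy]
    split_ifs <;> simp
  rw [e1] at key
  refine key.trans (le_of_eq ?_)
  set W := ∑ x ∈ X.linkVerts s, leftWeight (X.linkVerts s) (X.linkWeight s) x
  set M := ∑ x ∈ X.linkVerts s, leftWeight (X.linkVerts s) (X.linkWeight s) x * f x
  have hM := hl f
  have hF := hl fun x => f x ^ 2
  have hW : W = (s.card + 2 : ℝ) * ((s.card + 1) * X.faceProb s) / X.linkMass s := by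
    rw [← e0]; field_simp
  have hM' : M = (s.card + 2 : ℝ) * (∑ x ∈ X.linkVerts s, X.faceProb (insert x s) * f x) /
      X.linkMass s := by
    rw [← hM]; field_simp; rfl
  rw [mul_add, mul_left_comm _ γ, hF, hW, hM']
  congr 1
  field_simp

end WeightedComplex

theorem sq_sum_eq_sum_sq_add_offDiag {α : Type*} [DecidableEq α] (T : Finset α) (f : α → ℝ) :
    (∑ x ∈ T, f x) ^ 2 = ∑ x ∈ T, f x ^ 2 + ∑ z ∈ T.offDiag, f z.1 * f z.2 := by
  rw [sq, Finset.sum_mul_sum, ← Finset.sum_product', ← Finset.diag_union_offDiag,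
    Finset.sum_union (Finset.disjoint_diag_offDiag T), Finset.sum_diag]
  simp_rw [sq]

namespace WeightedComplex

variable {V : Type u} [DecidableEq V] {d : ℕ} {X : WeightedComplex V d}

/-- The dual form of `UpBound` between consecutive layers. -/
theorem UpBound.dual {k : ℕ} (hk : k + 1 ≤ d + 1) {c : ℝ} (hc : 0 ≤ c)
    (h : X.UpBound k (k + 1) c) {g : Finset V → ℝ}
    (hg : ∑ S ∈ X.layer (k + 1), X.faceProb S * g S = 0) :
    ∑ R ∈ X.layer k,
        (∑ x ∈ X.linkVerts R, X.faceProb (insert x R) * g (insert x R)) ^ 2 / X.faceProb R ≤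
      (k + 1 : ℝ) ^ 2 * c * ∑ S ∈ X.layer (k + 1), X.faceProb S * g S ^ 2 := by
  have hw : ∀ S ∈ X.layer (k + 1), ∀ R ∈ X.layer k, 0 ≤ X.inclWeight 1 S R :=
    fun S _ R _ => inclWeight_nonneg zero_le_one S R
  have hl : ∀ F : Finset V → ℝ,
      ∑ S ∈ X.layer (k + 1), leftWeight (X.layer k) (X.inclWeight 1) S * F S =
        (k + 1 : ℝ) * ∑ S ∈ X.layer (k + 1), X.faceProb S * F S := by
    intro F
    rw [Finset.mul_sum]
    refine Finset.sum_congr rfl fun S hS => ?_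
    rw [leftWeight_inclWeight hS, Nat.choose_succ_self_right]
    push_cast; ring
  -- `UpBound` concerns averaging from below; passing to the adjoint gives the same constant for
  -- averaging over the faces above.
  have key := (h.avgBound (Nat.le_succ k) hk one_pos).walkOp_le hw hc g (by
    rw [hl, hg, mul_zero])
  rw [hl] at key
  have hr : ∑ R ∈ X.layer k, rightWeight (X.layer (k + 1)) (X.inclWeight 1) R *
      walkOp (X.layer (k + 1)) (X.inclWeight 1) g R ^ 2 = (∑ R ∈ X.layer k,
        (∑ x ∈ X.linkVerts R, X.faceProb (insert x R) * g (insert x R)) ^ 2 / X.faceProb R) /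
        (k + 1 : ℝ) := by
    rw [Finset.sum_div]
    refine Finset.sum_congr rfl fun R hR => ?_
    have hP := X.faceProb_pos (PureComplex.mem_layer.1 hR).1
    have hrw : rightWeight (X.layer (k + 1)) (X.inclWeight 1) R = (k + 1 : ℝ) * X.faceProb R := by
      rw [rightWeight_inclWeight (Nat.le_succ k) hk hR, Nat.succ_eq_add_one,
        Nat.choose_succ_self_right]
      push_cast; ring
    have hnum : ∑ S ∈ X.layer (k + 1), X.inclWeight 1 S R * g S =
        ∑ x ∈ X.linkVerts R, X.faceProb (insert x R) * g (insert x R) := by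
      rw [X.sum_linkVerts fun S => X.faceProb S * g S, (PureComplex.mem_layer.1 hR).2,
        Finset.sum_filter]
      refine Finset.sum_congr rfl fun S _ => ?_
      unfold inclWeight
      split_ifs <;> simp
    rw [walkOp, hnum, hrw]
    field_simp
  rw [hr, div_le_iff₀ (by positivity)] at key
  calc _ ≤ _ := key
    _ = _ := by ring

/-- The local-to-global step: a spectral gap for walks between smaller faces and in the links gives
one for walks between larger faces. -/
theorem UpBound.succ {k : ℕ} {γ c : ℝ} (hX : X.IsTwoSidedExpander γ) (hk : k + 2 ≤ d + 1)
    (hc : 0 ≤ c) (h : X.UpBound k (k + 1) c) :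
    X.UpBound (k + 1) (k + 2) ((1 + (k + 1) * (c + γ)) / (k + 2)) := by
  intro g hg
  set N := ∑ S ∈ X.layer (k + 1), X.faceProb S * g S ^ 2 with hN
  have hdual := h.dual (by omega) hc hg
  have hlink : ∑ R ∈ X.layer k, ∑ x ∈ X.linkVerts R, X.faceProb (insert x R) * g (insert x R) ^ 2
      = (k + 1 : ℝ) * N := by
    have : ∀ R ∈ X.layer k,
        ∑ x ∈ X.linkVerts R, X.faceProb (insert x R) * g (insert x R) ^ 2 =
          ∑ S ∈ (X.layer (k + 1)).filter (fun S => R ⊆ S), X.faceProb S * g S ^ 2 := by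
      intro R hR
      rw [X.sum_linkVerts fun S => X.faceProb S * g S ^ 2, (PureComplex.mem_layer.1 hR).2]
    rw [Finset.sum_congr rfl this,
      ← X.sum_layer_powersetCard fun S _ => X.faceProb S * g S ^ 2, hN, Finset.mul_sum]
    refine Finset.sum_congr rfl fun S hS => ?_
    rw [Finset.sum_const, Finset.card_powersetCard, (PureComplex.mem_layer.1 hS).2,
      Nat.choose_succ_self_right, nsmul_eq_mul]
    push_cast; ring
  have hdiag : ∑ T ∈ X.layer (k + 2), X.faceProb T * ∑ x ∈ T, g (T.erase x) ^ 2 =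
      (k + 2 : ℝ) * N := by
    have := X.sum_faceProb_mul_powersetCard (i := k + 1) (j := k + 2) (by omega) hk
      fun S => g S ^ 2
    rw [Nat.choose_succ_self_right] at this
    rw [Finset.sum_congr rfl fun T hT => by
      rw [← sum_powersetCard_eq_sum_erase (PureComplex.mem_layer.1 hT).2 fun S => g S ^ 2], this]
    push_cast; ring
  -- Cross terms: two distinct facets of `T` meet in a `k`-element face `R` and form an edge of its
  -- link. The mean part of the link estimate, summed over `R`, contributes `c` through `hdual`; the
  -- rest contributes `γ`.
  have hoff : ∑ T ∈ X.layer (k + 2), X.faceProb T *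
      ∑ z ∈ T.offDiag, g (T.erase z.1) * g (T.erase z.2) ≤
        (k + 2 : ℝ) * (k + 1) * (c + γ) * N := by
    have e := sum_layer_offDiag (X := X) (k := k) (fun T S S' => X.faceProb T * g S * g S')
      fun T hT S S' => by rw [X.faceProb_eq_zero hT]; ring
    simp_rw [Finset.mul_sum, ← mul_assoc]
    rw [e]
    have hR : ∀ R ∈ X.layer k, ∑ x ∈ X.linkVerts R, ∑ y ∈ X.linkVerts R,
        (if x ≠ y then X.faceProb (insert x (insert y R)) * g (insert x R) * g (insert y R)
          else 0) ≤ (k + 2 : ℝ) / (k + 1) * ((∑ x ∈ X.linkVerts R,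
            X.faceProb (insert x R) * g (insert x R)) ^ 2 / X.faceProb R) +
        γ * ((k + 2) * ∑ x ∈ X.linkVerts R, X.faceProb (insert x R) * g (insert x R) ^ 2) := by
      intro R hR
      obtain ⟨hRf, hRc⟩ := PureComplex.mem_layer.1 hR
      have := hX.link_quadForm_le hRf (by omega) fun x => g (insert x R)
      rwa [hRc] at this
    refine (Finset.sum_le_sum hR).trans ?_
    rw [Finset.sum_add_distrib, ← Finset.mul_sum, ← Finset.mul_sum, ← Finset.mul_sum, hlink]
    have : (k + 2 : ℝ) / (k + 1) * ∑ R ∈ X.layer k, (∑ x ∈ X.linkVerts R,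
            X.faceProb (insert x R) * g (insert x R)) ^ 2 / X.faceProb R ≤
        (k + 2 : ℝ) / (k + 1) * ((k + 1 : ℝ) ^ 2 * c * N) :=
      mul_le_mul_of_nonneg_left hdual (by positivity)
    have e2 : (k + 2 : ℝ) / (k + 1) * ((k + 1 : ℝ) ^ 2 * c * N) =
        (k + 2 : ℝ) * (k + 1) * c * N := by
      field_simp
    rw [e2] at this
    linarith
  -- Expanding the square of the average over the `k + 2` facets of `T`.
  have hsum : ∑ T ∈ X.layer (k + 2), X.faceProb T * subsetAvg (k + 1) g T ^ 2 =
      (∑ T ∈ X.layer (k + 2), X.faceProb T * ∑ x ∈ T, g (T.erase x) ^ 2 +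
        ∑ T ∈ X.layer (k + 2), X.faceProb T *
          ∑ z ∈ T.offDiag, g (T.erase z.1) * g (T.erase z.2)) / (k + 2 : ℝ) ^ 2 := by
    rw [← Finset.sum_add_distrib, Finset.sum_div]
    refine Finset.sum_congr rfl fun T hT => ?_
    have hc := (PureComplex.mem_layer.1 hT).2
    rw [← mul_add, ← sq_sum_eq_sum_sq_add_offDiag T fun x => g (T.erase x), subsetAvg,
      sum_powersetCard_eq_sum_erase hc, hc, Nat.choose_succ_self_right]
    push_cast
    rw [show (k : ℝ) + 1 + 1 = k + 2 by ring, div_pow, mul_div_assoc]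
  rw [hsum, hdiag, div_le_iff₀ (by positivity)]
  have e3 : (1 + (k + 1) * (c + γ)) / (k + 2) * N * (k + 2 : ℝ) ^ 2 =
      (k + 2) * N + (k + 2 : ℝ) * (k + 1) * (c + γ) * N := by
    field_simp
  rw [e3]
  linarith

theorem upBound_zero : X.UpBound 0 1 0 := by
  intro g hg
  have h0 : X.layer 0 = {∅} := by
    ext s
    rw [PureComplex.mem_layer, Finset.card_eq_zero, Finset.mem_singleton, and_iff_right_iff_imp]
    rintro rfl
    exact X.empty_mem_faces
  rw [h0, Finset.sum_singleton, X.faceProb_empty, one_mul] at hg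
  simp [subsetAvg, hg]

/-- The constant is the exact solution of the recursion `c ↦ (1 + (k + 1) * (c + γ)) / (k + 2)`
started at `c = 0`. It starts at zero because a mean-zero function on the empty face vanishes. -/
theorem IsTwoSidedExpander.upBound_succ {γ : ℝ} (hX : X.IsTwoSidedExpander γ) (hγ : 0 ≤ γ)
    {k : ℕ} (hk : k + 1 ≤ d + 1) : X.UpBound k (k + 1) (k / (k + 1) + k * γ / 2) := by
  induction k with
  | zero => simpa using upBound_zero (X := X)
  | succ k ih =>
    have h := (ih (by omega)).succ hX hk (by positivity)
    convert h using 1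
    push_cast
    field_simp
    ring

/-- Compose the one-step bounds: the factors `j / (j + 1)` telescope to `i / j`. The error term may
grow by `i * γ` at each step, and this allowance is enough in both regimes of `γ` treated below. -/
theorem IsTwoSidedExpander.upBound {γ : ℝ} (hX : X.IsTwoSidedExpander γ) (hγ : 0 ≤ γ)
    {i j : ℕ} (hi : 1 ≤ i) (hij : i ≤ j) (hj : j ≤ d + 1) :
    X.UpBound i j (i / j + i * j * γ) := by
  induction j, hij using Nat.le_induction with
  | base =>
    refine (upBound_one le_rfl hj).mono ?_
    have : (0 : ℝ) < i := by exact_mod_cast hi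
    rw [div_self this.ne']
    have : 0 ≤ (i : ℝ) * i * γ := by positivity
    linarith
  | succ j hij ih =>
    have hi0 : (0 : ℝ) < i := by exact_mod_cast hi
    have hj1 : (1 : ℝ) ≤ j := by exact_mod_cast hi.trans hij
    have ih' := ih (by omega)
    push_cast
    -- When `j ^ 2 * γ ≤ 1`, the second-order error is at most half of the allowance `i * γ`.
    -- Otherwise plain contraction suffices, because the unused gain `i / j - i / (j + 1) = i / (j *
    -- (j + 1))` is itself at most `i * γ`.
    by_cases hsmall : (j : ℝ) ^ 2 * γ ≤ 1
    · refine (ih'.trans hij (Nat.le_succ j) hj (by positivity)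
        (hX.upBound_succ hγ hj)).mono ?_
      have e : ((j : ℝ) / (j + 1) + j * γ / 2) * (i / j + i * j * γ) =
          i / (j + 1) + i * γ * (1 / 2 + j ^ 2 / (j + 1) + j ^ 2 * γ / 2) := by
        field_simp
        ring
      have h2 : (j : ℝ) ^ 2 / (j + 1) ≤ j := by
        rw [div_le_iff₀ (by positivity)]; nlinarith
      rw [e]
      have : (i : ℝ) * γ * (1 / 2 + j ^ 2 / (j + 1) + j ^ 2 * γ / 2) ≤ i * γ * (j + 1) :=
        mul_le_mul_of_nonneg_left (by linarith) (by positivity)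
      linarith
    · push Not at hsmall
      have h := ih'.trans hij (Nat.le_succ j) hj zero_le_one (upBound_one (Nat.le_succ j) hj)
      refine h.mono ?_
      have e : (i : ℝ) / j = i / (j + 1) + i * (1 / (j * (j + 1))) := by
        field_simp
      have h2 : (1 : ℝ) / (j * (j + 1)) ≤ γ := by
        rw [div_le_iff₀ (by positivity)]
        nlinarith
      rw [one_mul, e]
      nlinarith [mul_le_mul_of_nonneg_left h2 hi0.le]

/-- Positive dimension is needed so that the empty face has a link condition. -/
theorem IsTwoSidedExpander.nonneg {γ : ℝ} (hX : X.IsTwoSidedExpander γ) (hd : 0 < d) : 0 ≤ γ :=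
  (lambda_nonneg _ _ _).trans (hX ∅ X.empty_mem_faces (by simpa using hd))

end WeightedComplex

/-! ### The path distribution: the two inclusion graphs and the graph inside one face. -/

theorem AvgBound.congr {U V : Type*} {A : Finset U} {B : Finset V} {w w' : U → V → ℝ} {c : ℝ}
    (hw : ∀ a ∈ A, ∀ b ∈ B, w a b = w' a b) (h : AvgBound A B w c) : AvgBound A B w' c := by
  have hl : ∀ a ∈ A, leftWeight B w' a = leftWeight B w a := fun a ha =>
    Finset.sum_congr rfl fun b hb => (hw a ha b hb).symm
  have hr : ∀ F : V → ℝ, ∑ b ∈ B, rightWeight A w' b * F b = ∑ b ∈ B, rightWeight A w b * F b :=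
    fun F => Finset.sum_congr rfl fun b hb => by
      unfold rightWeight
      rw [Finset.sum_congr rfl fun a ha => (hw a ha b hb).symm]
  intro g hg
  rw [hr] at hg ⊢
  refine le_trans (le_of_eq (Finset.sum_congr rfl fun a ha => ?_)) (h g hg)
  rw [hl a ha, Finset.sum_congr rfl fun b hb => by rw [← hw a ha b hb]]

/-- The second moment of the sum of a mean-zero function over a random subset. -/
theorem sum_powersetCard_sq_sum {α : Type*} [DecidableEq α] {T : Finset α} {a b : ℕ}
    (hT : T.card = b + 2) {g : α → ℝ} (hg : ∑ x ∈ T, g x = 0) :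
    ∑ S ∈ T.powersetCard (a + 1), (∑ x ∈ S, g x) ^ 2 = (b.choose a : ℝ) * ∑ x ∈ T, g x ^ 2 := by
  have hoff := sq_sum_eq_sum_sq_add_offDiag T g
  rw [hg] at hoff
  simp_rw [sq_sum_eq_sum_sq_add_offDiag]
  rw [Finset.sum_add_distrib]
  have h1 : ∑ S ∈ T.powersetCard (a + 1), ∑ x ∈ S, g x ^ 2 =
      ((b + 1).choose a : ℝ) * ∑ x ∈ T, g x ^ 2 := by
    rw [Finset.sum_comm' (t' := T)
      (s' := fun x => (T.powersetCard (a + 1)).filter (fun S => {x} ⊆ S)), Finset.mul_sum]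
    · refine Finset.sum_congr rfl fun x hx => ?_
      rw [Finset.sum_const, Finset.card_filter_powersetCard_subset _ _ _
        (Finset.singleton_subset_iff.2 hx) (by simp), hT, nsmul_eq_mul]
      simp
    · intro S x
      simp only [Finset.mem_powersetCard, Finset.mem_filter, Finset.singleton_subset_iff]
      exact ⟨fun h => ⟨⟨h.1, h.2⟩, h.1.1 h.2⟩, fun h => ⟨h.1.1, h.1.2⟩⟩
  -- By Pascal's rule the difference of binomials counts the subsets through a given pair. In this
  -- form it also covers `a = 0`, where there are none.
  have h2 : ∑ S ∈ T.powersetCard (a + 1), ∑ z ∈ S.offDiag, g z.1 * g z.2 =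
      (((b + 1).choose a : ℝ) - b.choose a) * ∑ z ∈ T.offDiag, g z.1 * g z.2 := by
    rw [Finset.sum_comm' (t' := T.offDiag)
      (s' := fun z => (T.powersetCard (a + 1)).filter (fun S => {z.1, z.2} ⊆ S)),
      Finset.mul_sum]
    · refine Finset.sum_congr rfl fun z hz => ?_
      obtain ⟨hz1, hz2, hne⟩ := Finset.mem_offDiag.1 hz
      have hcard : ({z.1, z.2} : Finset α).card = 2 := Finset.card_pair hne
      rw [Finset.sum_const, nsmul_eq_mul]
      congr 1
      cases a with
      | zero =>
        rw [Finset.card_eq_zero.2]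
        · simp
        · refine Finset.filter_eq_empty_iff.2 fun S hS hsub => ?_
          have := Finset.card_le_card hsub
          rw [hcard, (Finset.mem_powersetCard.1 hS).2] at this
          omega
      | succ a =>
        rw [Finset.card_filter_powersetCard_subset _ _ _
          (Finset.insert_subset hz1 (Finset.singleton_subset_iff.2 hz2)) (by rw [hcard]; omega),
          hT, hcard, Nat.choose_succ_succ b a]
        simp
    · intro S z
      simp only [Finset.mem_powersetCard, Finset.mem_filter, Finset.insert_subset_iff,
        Finset.singleton_subset_iff, Finset.mem_offDiag]
      exact ⟨fun h => ⟨⟨h.1, h.2.1, h.2.2.1⟩, h.1.1 h.2.1, h.1.1 h.2.2.1, h.2.2.2⟩,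
        fun h => ⟨h.1.1, h.1.2.1, h.1.2.2, h.2.2.2⟩⟩
  rw [h1, h2]
  -- Since `g` has sum zero, the off-diagonal sum is minus the diagonal one, and only `b.choose a`
  -- survives.
  linear_combination (-(((b + 1).choose a : ℝ) - b.choose a)) * hoff

namespace WeightedComplex

variable {V : Type u} [DecidableEq V] {d : ℕ} {X : WeightedComplex V d}

theorem lowerNbrs_eq {m₁ m₂ : ℕ} {T : Finset V} (hT : T ∈ X.layer m₂) :
    X.lowerNbrs m₁ T = T.powersetCard m₁ :=
  filter_layer_subset hT

theorem filter_verts_mem {S : Finset V} (hS : S ∈ X.faces) :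
    X.verts.filter (fun y => y ∈ S) = S := by
  ext x
  rw [Finset.mem_filter, and_iff_right_iff_imp]
  exact X.mem_verts_of_mem hS

theorem pathProb_eq {m₁ m₂ : ℕ} {T S : Finset V} (hT : T ∈ X.layer m₂) (hS : S ∈ X.layer m₁)
    (x : V) : X.pathProb m₁ T S x =
      if S ⊆ T ∧ x ∈ S then X.faceProb T * (1 / (m₂.choose m₁ : ℝ)) * (1 / (m₁ : ℝ)) else 0 := by
  obtain ⟨hSf, hSc⟩ := PureComplex.mem_layer.1 hS
  rw [pathProb, lowerNbrs_eq hT, Finset.card_powersetCard, (PureComplex.mem_layer.1 hT).2,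
    filter_verts_mem hSf, hSc]

theorem weight21_eq {m₁ m₂ : ℕ} (h1 : 1 ≤ m₁) {T S : Finset V} (hT : T ∈ X.layer m₂)
    (hS : S ∈ X.layer m₁) :
    X.weight21 m₁ T S = X.inclWeight (1 / (m₂.choose m₁ : ℝ)) T S := by
  obtain ⟨hSf, hSc⟩ := PureComplex.mem_layer.1 hS
  have hm : (m₁ : ℝ) ≠ 0 := by exact_mod_cast Nat.one_le_iff_ne_zero.1 h1
  unfold weight21 inclWeight
  simp_rw [pathProb_eq hT hS]
  by_cases h : S ⊆ T
  · simp_rw [h, true_and, if_true]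
    rw [← Finset.sum_filter, filter_verts_mem hSf, Finset.sum_const, hSc, nsmul_eq_mul]
    field_simp
  · simp [h]

/-- A uniform `m₁`-subset of a random `m₂`-face is a random `m₁`-face, so summing out `T` leaves no
trace of `m₂`. -/
theorem weight10_eq {m₁ m₂ : ℕ} (h12 : m₁ ≤ m₂) (h2 : m₂ ≤ d + 1) {S : Finset V}
    (hS : S ∈ X.layer m₁) (x : V) :
    X.weight10 m₁ m₂ S x = X.inclWeight (1 / (m₁ : ℝ)) S {x} := by
  have hc := (PureComplex.mem_layer.1 hS).2
  have hch : (0 : ℝ) < (m₂.choose m₁ : ℝ) := by exact_mod_cast Nat.choose_pos h12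
  unfold weight10 inclWeight
  rw [Finset.sum_congr rfl fun T hT => pathProb_eq hT hS x]
  by_cases hx : x ∈ S
  · simp_rw [hx, and_true, Finset.singleton_subset_iff, hx, if_true]
    rw [← Finset.sum_filter, ← Finset.sum_mul, ← Finset.sum_mul,
      X.sum_faceProb_superset (hc.le.trans h12) h2, hc]
    field_simp
  · simp [hx]

theorem pi1_eq {m₁ m₂ : ℕ} (h1 : 1 ≤ m₁) (h12 : m₁ ≤ m₂) (h2 : m₂ ≤ d + 1) {S : Finset V}
    (hS : S ∈ X.layer m₁) : X.pi1 m₁ m₂ S = X.faceProb S := by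
  have hc := (PureComplex.mem_layer.1 hS).2
  have hch : (0 : ℝ) < (m₂.choose m₁ : ℝ) := by exact_mod_cast Nat.choose_pos h12
  have : X.pi1 m₁ m₂ S = ∑ T ∈ X.layer m₂, X.inclWeight (1 / (m₂.choose m₁ : ℝ)) T S :=
    Finset.sum_congr rfl fun T hT => weight21_eq h1 hT hS
  rw [this, ← rightWeight, rightWeight_inclWeight h12 h2 hS]
  field_simp

theorem sum_layer_one (F : Finset V → ℝ) : ∑ S ∈ X.layer 1, F S = ∑ x ∈ X.verts, F {x} := by
  symm
  refine Finset.sum_nbij (fun x => {x}) ?_ (fun x _ y _ h => Finset.singleton_injective h) ?_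
    fun _ _ => rfl
  · intro x hx
    exact PureComplex.mem_layer.2 ⟨X.mem_verts.1 hx, Finset.card_singleton x⟩
  · intro S hS
    obtain ⟨hS, hc⟩ := PureComplex.mem_layer.1 hS
    obtain ⟨x, rfl⟩ := Finset.card_eq_one.1 hc
    exact ⟨x, X.mem_verts.2 hS, rfl⟩

theorem IsTwoSidedExpander.lambda21_sq_le {γ : ℝ} (hX : X.IsTwoSidedExpander γ) (hγ : 0 ≤ γ)
    {m₁ m₂ : ℕ} (h1 : 1 ≤ m₁) (h12 : m₁ ≤ m₂) (h2 : m₂ ≤ d + 1) :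
    X.lambda21 m₁ m₂ ^ 2 ≤ (m₁ : ℝ) / m₂ + m₁ * m₂ * γ := by
  have hch : (0 : ℝ) < (m₂.choose m₁ : ℝ) := by exact_mod_cast Nat.choose_pos h12
  refine lambda_sq_le (fun T hT S hS => ?_) (by positivity)
    (((hX.upBound hγ h1 h12 h2).avgBound h12 h2 (one_div_pos.2 hch)).congr
      fun T hT S hS => (weight21_eq h1 hT hS).symm)
  rw [weight21_eq h1 hT hS]
  exact inclWeight_nonneg (by positivity) T S

theorem IsTwoSidedExpander.lambda10_sq_le {γ : ℝ} (hX : X.IsTwoSidedExpander γ) (hγ : 0 ≤ γ)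
    {m₁ m₂ : ℕ} (h1 : 1 ≤ m₁) (h12 : m₁ ≤ m₂) (h2 : m₂ ≤ d + 1) :
    X.lambda10 m₁ m₂ ^ 2 ≤ 1 / (m₁ : ℝ) + m₁ * γ := by
  have hm : (0 : ℝ) < (m₁ : ℝ) := by exact_mod_cast h1
  refine lambda_sq_le (fun S hS x hx => ?_) (by positivity) (AvgBound.congr
    (w := fun S x => X.inclWeight (1 / (m₁ : ℝ)) S {x})
    (fun S hS x _ => (weight10_eq h12 h2 hS x).symm) ?_)
  · rw [weight10_eq h12 h2 hS]
    exact inclWeight_nonneg (by positivity) _ _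
  have key := (hX.upBound hγ le_rfl h1 (h12.trans h2)).avgBound h1 (h12.trans h2)
    (one_div_pos.2 hm)
  intro g hg
  -- The right side is the set of points rather than singleton faces; summing `g` over a face
  -- extends it to all faces and recovers `g x` at `{x}`.
  have := key fun S => ∑ x ∈ S, g x
  simp only [sum_layer_one, Finset.sum_singleton, leftWeight, Nat.cast_one, one_mul] at this
  exact this hg

theorem localWeight_eq {m₁ m₂ : ℕ} {T S : Finset V} (hT : T ∈ X.layer m₂) (hS : S ∈ X.layer m₁)
    (x : V) : X.localWeight m₁ T S x =
      if S ⊆ T ∧ x ∈ S then 1 / ((m₂.choose m₁ : ℝ) * m₁) else 0 := by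
  have := (X.faceProb_pos (PureComplex.mem_layer.1 hT).1).ne'
  rw [localWeight, pathProb_eq hT hS]
  split_ifs
  · field_simp
  · exact zero_div _

theorem pi0Given_eq {m₁ m₂ : ℕ} (h1 : 1 ≤ m₁) (h12 : m₁ ≤ m₂) {T : Finset V}
    (hT : T ∈ X.layer m₂) (x : V) :
    X.pi0Given m₁ T x = if x ∈ T then 1 / (T.card : ℝ) else 0 := by
  have hc := (PureComplex.mem_layer.1 hT).2
  unfold pi0Given
  rw [Finset.sum_congr rfl fun S hS => localWeight_eq hT hS x]
  split_ifs with hx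
  · obtain ⟨a, rfl⟩ : ∃ a, m₁ = a + 1 := ⟨m₁ - 1, by omega⟩
    obtain ⟨b, rfl⟩ : ∃ b, m₂ = b + 1 := ⟨m₂ - 1, by omega⟩
    have hch : (0 : ℝ) < ((b + 1).choose (a + 1) : ℝ) := by exact_mod_cast Nat.choose_pos h12
    have hid : ((b : ℝ) + 1) * (b.choose a : ℝ) = ((b + 1).choose (a + 1) : ℝ) * (a + 1) := by
      exact_mod_cast Nat.add_one_mul_choose_eq b a
    have hcount := Finset.card_filter_powersetCard_subset {x} T (a + 1)
      (Finset.singleton_subset_iff.2 hx) (by simp)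
    simp_rw [Finset.singleton_subset_iff] at hcount
    rw [← Finset.sum_filter, ← Finset.filter_filter, filter_layer_subset hT, Finset.sum_const,
      hcount, hc, nsmul_eq_mul]
    simp only [Finset.card_singleton, Nat.add_sub_cancel]
    push_cast
    rw [mul_one_div, div_eq_div_iff (by positivity) (by positivity)]
    linarith
  · exact Finset.sum_eq_zero fun S _ => if_neg fun h => hx (h.1 h.2)

/-- The adjoint takes `g` to the mean of `g` over a uniform `m₁`-sample from `T` without
replacement. The variance of this mean is that of `g` times `1 / m₁` and the finite-population
correction, so the adjoint estimate holds with equality. -/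
theorem lambdaLocal_sq_le {m₁ m₂ : ℕ} (h1 : 1 ≤ m₁) (h12 : m₁ < m₂) {T : Finset V}
    (hT : T ∈ X.layer m₂) :
    X.lambdaLocal m₁ T ^ 2 ≤ 1 / (m₁ : ℝ) * (((m₂ : ℝ) - m₁) / ((m₂ : ℝ) - 1)) := by
  obtain ⟨hTf, hc⟩ := PureComplex.mem_layer.1 hT
  obtain ⟨a, rfl⟩ : ∃ a, m₁ = a + 1 := ⟨m₁ - 1, by omega⟩
  obtain ⟨b, rfl⟩ : ∃ b, m₂ = b + 2 := ⟨m₂ - 2, by omega⟩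
  have hab : (a : ℝ) ≤ b := by exact_mod_cast (show a ≤ b by omega)
  have hch : (0 : ℝ) < ((b + 2).choose (a + 1) : ℝ) := by exact_mod_cast Nat.choose_pos h12.le
  have hw : ∀ S ∈ X.lowerNbrs (a + 1) T, ∀ x ∈ T, X.localWeight (a + 1) T S x =
      if x ∈ S then 1 / (((b + 2).choose (a + 1) : ℝ) * (a + 1)) else 0 := by
    intro S hS x _
    obtain ⟨hS, hST⟩ := Finset.mem_filter.1 hS
    rw [localWeight_eq hT hS]
    simp [hST]
  have hr : ∀ x ∈ T, rightWeight (X.lowerNbrs (a + 1) T) (X.localWeight (a + 1) T) x =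
      1 / ((b : ℝ) + 2) := by
    intro x hx
    have h := pi0Given_eq h1 h12.le hT x
    rw [if_pos hx, hc] at h
    push_cast at h
    rw [← h, rightWeight, pi0Given, lowerNbrs]
    refine Finset.sum_subset (Finset.filter_subset _ _) fun S hS hS' => ?_
    rw [localWeight_eq hT hS, if_neg]
    exact fun h => hS' (Finset.mem_filter.2 ⟨hS, h.1⟩)
  have hrow : ∀ S ∈ X.lowerNbrs (a + 1) T, ∀ F : V → ℝ,
      ∑ x ∈ T, X.localWeight (a + 1) T S x * F x =
        1 / (((b + 2).choose (a + 1) : ℝ) * (a + 1)) * ∑ x ∈ S, F x := by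
    intro S hS F
    have hST : T.filter (fun x => x ∈ S) = S := by
      rw [Finset.filter_mem_eq_inter, Finset.inter_eq_right.2 (Finset.mem_filter.1 hS).2]
    have hsum : ∑ x ∈ S, F x = ∑ x ∈ T.filter (fun x => x ∈ S), F x := by rw [hST]
    rw [hsum, Finset.mul_sum, Finset.sum_filter]
    refine Finset.sum_congr rfl fun x hx => ?_
    rw [hw S hS x hx]
    split_ifs <;> simp
  refine lambda_sq_le (fun S hS x hx => ?_) ?_ fun g hg => ?_
  · rw [hw S hS x hx]
    split_ifs <;> positivity
  · push_cast
    exact mul_nonneg (by positivity) (div_nonneg (by linarith) (by linarith))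
  have hr' : ∀ F : V → ℝ, ∑ x ∈ T,
      rightWeight (X.lowerNbrs (a + 1) T) (X.localWeight (a + 1) T) x * F x =
        1 / ((b : ℝ) + 2) * ∑ x ∈ T, F x := by
    intro F
    rw [Finset.mul_sum]
    exact Finset.sum_congr rfl fun x hx => by rw [hr x hx]
  rw [hr'] at hg ⊢
  have hg' : ∑ x ∈ T, g x = 0 := (mul_eq_zero.1 hg).resolve_left (by positivity)
  have hl : ∀ S ∈ X.lowerNbrs (a + 1) T, (∑ x ∈ T, X.localWeight (a + 1) T S x * g x) ^ 2 /
      leftWeight T (X.localWeight (a + 1) T) S =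
        1 / (((b + 2).choose (a + 1) : ℝ) * (a + 1) ^ 2) * (∑ x ∈ S, g x) ^ 2 := by
    intro S hS
    have h := hrow S hS fun _ => 1
    simp only [mul_one] at h
    have hSc := (PureComplex.mem_layer.1 (Finset.mem_filter.1 hS).1).2
    rw [hrow S hS, leftWeight, h, Finset.sum_const, hSc, nsmul_eq_mul]
    push_cast
    field_simp
  rw [Finset.sum_congr rfl hl, ← Finset.mul_sum, lowerNbrs_eq hT, sum_powersetCard_sq_sum hc hg']
  -- This identity turns the ratio of binomials into the stated fraction.
  have hid : (b.choose a : ℝ) * ((b + 1) * (b + 2)) =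
      ((b + 2).choose (a + 1) : ℝ) * ((a + 1) * (b + 1 - a)) := by
    have e1 : ((b : ℝ) + 1 + 1) * ((b + 1).choose a : ℝ) =
        ((b + 2).choose (a + 1) : ℝ) * (a + 1) := by
      exact_mod_cast Nat.add_one_mul_choose_eq (b + 1) a
    have e2 : ((b + 1).choose a : ℝ) * ((b : ℝ) + 1 - a) = (b.choose a : ℝ) * (b + 1) := by
      have := Nat.choose_mul_succ_eq b a
      rw [← Nat.cast_add_one, ← Nat.cast_sub (by omega)]
      exact_mod_cast this.symm
    linear_combination (-(b + 2 : ℝ)) * e2 + ((b : ℝ) + 1 - a) * e1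
  push_cast
  refine le_of_eq ?_
  rw [show (b : ℝ) + 2 - (a + 1) = b + 1 - a by ring, show (b : ℝ) + 2 - 1 = b + 1 by ring]
  field_simp
  linear_combination (∑ x ∈ T, g x ^ 2) * hid

end WeightedComplex

/-! ### The linear group acting on the building. -/

section Building

variable {𝔽 : Type v} [Field 𝔽] {n : ℕ}

theorem BTLattice.ext_carrier {L M : BTLattice 𝔽 n} (h : L.carrier = M.carrier) : L = M := by
  cases L; cases M; cases h; rfl

/-- The image of a lattice under a linear automorphism. -/
noncomputable def BTLattice.map (e : (Fin n → 𝔽⸨X⸩) ≃ₗ[𝔽⸨X⸩] (Fin n → 𝔽⸨X⸩))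
    (L : BTLattice 𝔽 n) : BTLattice 𝔽 n where
  carrier := L.carrier.map (e.toLinearMap.restrictScalars 𝔽⟦X⟧)
  fg := L.fg.map _
  span_eq_top := by
    have : ((L.carrier.map (e.toLinearMap.restrictScalars 𝔽⟦X⟧) : Submodule 𝔽⟦X⟧ _) :
        Set (Fin n → 𝔽⸨X⸩)) = e.toLinearMap '' (L.carrier : Set (Fin n → 𝔽⸨X⸩)) := rfl
    rw [this, Submodule.span_image, L.span_eq_top, Submodule.map_top, LinearEquiv.range]

theorem BTLattice.mem_map {e : (Fin n → 𝔽⸨X⸩) ≃ₗ[𝔽⸨X⸩] (Fin n → 𝔽⸨X⸩)} {L : BTLattice 𝔽 n}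
    {x : Fin n → 𝔽⸨X⸩} : x ∈ (L.map e).carrier ↔ e.symm x ∈ L.carrier := by
  constructor
  · rintro ⟨y, hy, rfl⟩
    change e.symm (e y) ∈ L.carrier
    rwa [LinearEquiv.symm_apply_apply]
  · exact fun h => ⟨e.symm x, h, e.apply_symm_apply x⟩

theorem BTLattice.map_symm_map (e : (Fin n → 𝔽⸨X⸩) ≃ₗ[𝔽⸨X⸩] (Fin n → 𝔽⸨X⸩))
    (L : BTLattice 𝔽 n) : (L.map e).map e.symm = L := by
  refine BTLattice.ext_carrier (Submodule.ext fun x => ?_)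
  rw [mem_map, mem_map, LinearEquiv.symm_symm, LinearEquiv.symm_apply_apply]

theorem BTLattice.toVertex_eq_iff {L M : BTLattice 𝔽 n} :
    L.toVertex = M.toVertex ↔ ∃ c : 𝔽⸨X⸩, c ≠ 0 ∧ ∀ x, x ∈ M.carrier ↔ c • x ∈ L.carrier :=
  Quotient.eq (r := homothety 𝔽 n)

/-- The action of a linear automorphism on the vertices of the building. -/
noncomputable def vertexMap (e : (Fin n → 𝔽⸨X⸩) ≃ₗ[𝔽⸨X⸩] (Fin n → 𝔽⸨X⸩)) :
    BTVertex 𝔽 n → BTVertex 𝔽 n :=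
  Quotient.map (sa := homothety 𝔽 n) (sb := homothety 𝔽 n) (BTLattice.map e) (by
    rintro L M ⟨c, hc, h⟩
    refine ⟨c, hc, fun x => ?_⟩
    rw [BTLattice.mem_map, BTLattice.mem_map, h, map_smul])

theorem vertexMap_toVertex (e : (Fin n → 𝔽⸨X⸩) ≃ₗ[𝔽⸨X⸩] (Fin n → 𝔽⸨X⸩))
    (L : BTLattice 𝔽 n) : vertexMap e L.toVertex = (L.map e).toVertex := rfl

theorem exists_toVertex (a : BTVertex 𝔽 n) : ∃ L : BTLattice 𝔽 n, L.toVertex = a :=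
  Quotient.exists_rep a

theorem vertexMap_symm_vertexMap (e : (Fin n → 𝔽⸨X⸩) ≃ₗ[𝔽⸨X⸩] (Fin n → 𝔽⸨X⸩))
    (a : BTVertex 𝔽 n) : vertexMap e.symm (vertexMap e a) = a := by
  obtain ⟨L, rfl⟩ := exists_toVertex a
  rw [vertexMap_toVertex, vertexMap_toVertex, BTLattice.map_symm_map]

theorem vertexMap_vertexMap_symm (e : (Fin n → 𝔽⸨X⸩) ≃ₗ[𝔽⸨X⸩] (Fin n → 𝔽⸨X⸩))
    (a : BTVertex 𝔽 n) : vertexMap e (vertexMap e.symm a) = a :=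
  vertexMap_symm_vertexMap e.symm a

theorem vertexMap_injective (e : (Fin n → 𝔽⸨X⸩) ≃ₗ[𝔽⸨X⸩] (Fin n → 𝔽⸨X⸩)) :
    Function.Injective (vertexMap e) :=
  Function.LeftInverse.injective (vertexMap_symm_vertexMap e)

theorem IsSimplex.image {σ : Set (BTVertex 𝔽 n)} (h : IsSimplex σ)
    (e : (Fin n → 𝔽⸨X⸩) ≃ₗ[𝔽⸨X⸩] (Fin n → 𝔽⸨X⸩)) : IsSimplex (vertexMap e '' σ) := by
  obtain ⟨r, h1, h2⟩ := h
  refine ⟨fun a => (r (vertexMap e.symm a)).map e, ?_, ?_⟩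
  · rintro _ ⟨a, ha, rfl⟩
    beta_reduce
    rw [vertexMap_symm_vertexMap, ← vertexMap_toVertex, h1 a ha]
  · rintro _ ⟨a, ha, rfl⟩ _ ⟨b, hb, rfl⟩
    beta_reduce
    rw [vertexMap_symm_vertexMap, vertexMap_symm_vertexMap]
    obtain ⟨h3, h4⟩ := h2 a ha b hb
    refine ⟨h3.imp (fun h => Submodule.map_mono h) (fun h => Submodule.map_mono h),
      fun x hx => ?_⟩
    rw [BTLattice.mem_map] at hx ⊢
    have := h4 _ hx
    rwa [show e.symm ((PowerSeries.X : 𝔽⟦X⟧) • x) = (PowerSeries.X : 𝔽⟦X⟧) • e.symm x from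
      (e.symm.toLinearMap.restrictScalars 𝔽⟦X⟧).map_smul _ _]

theorem IsSimplex.subset {σ τ : Set (BTVertex 𝔽 n)} (h : IsSimplex σ) (hτ : τ ⊆ σ) :
    IsSimplex τ := by
  obtain ⟨r, h1, h2⟩ := h
  exact ⟨r, fun a ha => h1 a (hτ ha), fun a ha b hb => h2 a (hτ ha) b (hτ hb)⟩

instance (L : BTLattice 𝔽 n) : Submodule.IsLattice 𝔽⸨X⸩ L.carrier := ⟨L.fg, L.span_eq_top⟩

/-- A lattice has a basis, which is also a basis of the ambient space. -/
theorem BTLattice.exists_basis (L : BTLattice 𝔽 n) :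
    ∃ b : Module.Basis (Fin n) 𝔽⸨X⸩ (Fin n → 𝔽⸨X⸩),
      L.carrier = Submodule.span 𝔽⟦X⟧ (Set.range b) := by
  have hr : Module.finrank 𝔽⟦X⟧ L.carrier = n := by
    rw [Submodule.IsLattice.finrank_of_pi 𝔽⸨X⸩ L.carrier, Fintype.card_fin]
  have : Module.Finite 𝔽⟦X⟧ L.carrier := Submodule.IsLattice.finite 𝔽⸨X⸩ L.carrier
  have : Module.Free 𝔽⟦X⟧ L.carrier := Submodule.IsLattice.free 𝔽⸨X⸩ L.carrier
  let b := Module.finBasisOfFinrankEq 𝔽⟦X⟧ L.carrier hr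
  refine ⟨b.extendOfIsLattice 𝔽⸨X⸩, ?_⟩
  have : (Set.range fun i => b.extendOfIsLattice 𝔽⸨X⸩ i) = L.carrier.subtype '' Set.range b := by
    rw [← Set.range_comp]
    congr 1
    funext i
    exact Module.Basis.extendOfIsLattice_apply 𝔽⸨X⸩ b i
  rw [this, ← Submodule.map_span, b.span_eq, Submodule.map_top, Submodule.range_subtype]

/-- The general linear group acts transitively on lattices. -/
theorem BTLattice.exists_map_eq (L M : BTLattice 𝔽 n) :
    ∃ e : (Fin n → 𝔽⸨X⸩) ≃ₗ[𝔽⸨X⸩] (Fin n → 𝔽⸨X⸩), L.map e = M := by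
  obtain ⟨b, hb⟩ := L.exists_basis
  obtain ⟨b', hb'⟩ := M.exists_basis
  refine ⟨b.equiv b' (Equiv.refl _), BTLattice.ext_carrier ?_⟩
  change L.carrier.map _ = _
  rw [hb, hb', Submodule.map_span, ← Set.range_comp]
  congr 2
  funext i
  simp

/-- A single group element identifying two vertices acts on the whole building within orbits. It can
therefore move an entire simplex to a chosen lift without changing its image in the quotient. -/
theorem SameOrbit.exists_vertexMap {Γ : Subgroup (Matrix.GeneralLinearGroup (Fin n) 𝔽⸨X⸩)}
    {a b : BTVertex 𝔽 n} (h : SameOrbit Γ a b) :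
    ∃ e : (Fin n → 𝔽⸨X⸩) ≃ₗ[𝔽⸨X⸩] (Fin n → 𝔽⸨X⸩),
      vertexMap e a = b ∧ ∀ c, SameOrbit Γ c (vertexMap e c) := by
  obtain ⟨g, hg, L, M, rfl, rfl, h⟩ := h
  let e : (Fin n → 𝔽⸨X⸩) ≃ₗ[𝔽⸨X⸩] (Fin n → 𝔽⸨X⸩) :=
    LinearEquiv.ofLinearMap (Matrix.mulVecLin (g : Matrix (Fin n) (Fin n) 𝔽⸨X⸩))
      (Matrix.mulVecLin ((g⁻¹ : Matrix.GeneralLinearGroup (Fin n) 𝔽⸨X⸩) :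
        Matrix (Fin n) (Fin n) 𝔽⸨X⸩))
      (by rw [← Matrix.mulVecLin_mul, ← Units.val_mul, mul_inv_cancel, Units.val_one,
        Matrix.mulVecLin_one])
      (by rw [← Matrix.mulVecLin_mul, ← Units.val_mul, inv_mul_cancel, Units.val_one,
        Matrix.mulVecLin_one])
  have he : ∀ x, e x = Matrix.mulVec (g : Matrix (Fin n) (Fin n) 𝔽⸨X⸩) x := fun x => rfl
  refine ⟨e, ?_, fun c => ?_⟩
  · rw [vertexMap_toVertex]
    congr 1
    refine BTLattice.ext_carrier (Submodule.ext fun x => ?_)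
    rw [BTLattice.mem_map, h, ← he, LinearEquiv.apply_symm_apply]
  · obtain ⟨N, rfl⟩ := exists_toVertex c
    refine ⟨g, hg, N, N.map e, rfl, rfl, fun x => ?_⟩
    rw [← he, BTLattice.mem_map, LinearEquiv.symm_apply_apply]

/-- The chambers of the building that contain the vertex `a`. -/
def chambersAt (a : BTVertex 𝔽 n) : Set (Set (BTVertex 𝔽 n)) :=
  {σ | IsSimplex σ ∧ a ∈ σ ∧ σ.ncard = n}

theorem image_mem_chambersAt {a : BTVertex 𝔽 n} {σ : Set (BTVertex 𝔽 n)} (h : σ ∈ chambersAt a)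
    (e : (Fin n → 𝔽⸨X⸩) ≃ₗ[𝔽⸨X⸩] (Fin n → 𝔽⸨X⸩)) :
    vertexMap e '' σ ∈ chambersAt (vertexMap e a) :=
  ⟨h.1.image e, Set.mem_image_of_mem _ h.2.1,
    (Set.ncard_image_of_injective σ (vertexMap_injective e)).trans h.2.2⟩

/-- All vertices of the building are in the same number of chambers. -/
theorem ncard_chambersAt (a b : BTVertex 𝔽 n) : (chambersAt a).ncard = (chambersAt b).ncard := by
  obtain ⟨L, rfl⟩ := exists_toVertex a
  obtain ⟨M, rfl⟩ := exists_toVertex b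
  obtain ⟨e, rfl⟩ := L.exists_map_eq M
  rw [← vertexMap_toVertex]
  have : chambersAt (vertexMap e L.toVertex) =
      (fun σ => vertexMap e '' σ) '' chambersAt L.toVertex := by
    refine Set.Subset.antisymm (fun σ hσ => ?_) ?_
    · refine ⟨vertexMap e.symm '' σ, ?_, ?_⟩
      · have := image_mem_chambersAt hσ e.symm
        rwa [vertexMap_symm_vertexMap] at this
      · change vertexMap e '' (vertexMap e.symm '' σ) = σ
        rw [Set.image_image]
        simp_rw [vertexMap_vertexMap_symm]
        exact Set.image_id' σ
    · rintro _ ⟨σ, hσ, rfl⟩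
      exact image_mem_chambersAt hσ e
  rw [this, Set.ncard_image_of_injective _ (Set.image_injective.2 (vertexMap_injective e))]

end Building

/-! ### Complete flags in a vector space. -/

/-- A complete flag of subspaces is spanned by the initial segments of a tuple of vectors. -/
theorem exists_span_image_eq {F E : Type*} [Field F] [AddCommGroup E] [Module F E]
    [FiniteDimensional F E] {n : ℕ} (W : ℕ → Submodule F E) (hmono : Monotone W)
    (hrank : ∀ i ≤ n, Module.finrank F (W i) = i) :
    ∃ v : Fin n → E, ∀ i ≤ n, Submodule.span F (v '' {j | (j : ℕ) < i}) = W i := by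
  have hex : ∀ i : Fin n, ∃ x ∈ W (i + 1), x ∉ W i := by
    intro i
    by_contra! h
    have h1 := Submodule.finrank_mono (show W (i + 1) ≤ W i from h)
    rw [hrank _ i.2, hrank _ i.2.le] at h1
    omega
  choose v hv hv' using hex
  refine ⟨v, fun i hi => ?_⟩
  induction i with
  | zero =>
    have : W 0 = ⊥ := Submodule.finrank_eq_zero.1 (hrank 0 (Nat.zero_le n))
    simp [this]
  | succ i ih =>
    have hset : {j : Fin n | (j : ℕ) < i + 1} = insert ⟨i, hi⟩ {j : Fin n | (j : ℕ) < i} := by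
      ext j
      simp only [Set.mem_ofPred_eq, Set.mem_insert_iff, Fin.ext_iff]
      omega
    rw [hset, Set.image_insert_eq, Submodule.span_insert, ih (by omega)]
    have hle : Submodule.span F {v ⟨i, hi⟩} ⊔ W i ≤ W (i + 1) :=
      sup_le ((Submodule.span_singleton_le_iff_mem _ _).2 (hv ⟨i, hi⟩)) (hmono (Nat.le_succ i))
    refine Submodule.eq_of_le_of_finrank_le hle ?_
    have hlt : W i < Submodule.span F {v ⟨i, hi⟩} ⊔ W i := by
      refine lt_of_le_of_ne le_sup_right fun h => hv' ⟨i, hi⟩ ?_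
      change v ⟨i, hi⟩ ∈ W i
      rw [h]
      exact Submodule.mem_sup_left (Submodule.mem_span_singleton_self _)
    have := Submodule.finrank_lt_finrank_of_lt hlt
    rw [hrank i (by omega)] at this
    rw [hrank _ hi]
    omega

/-- A chain of as many nonzero subspaces as the dimension is a complete flag, and is spanned by
the initial segments of a tuple of vectors. -/
theorem exists_span_image_eq_of_isChain {F : Type*} [Field F] {n : ℕ}
    {𝒞 : Set (Submodule F (Fin n → F))} (hchain : IsChain (· ≤ ·) 𝒞) (hbot : ⊥ ∉ 𝒞)
    (hcard : 𝒞.ncard = n) :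
    ∃ v : Fin n → Fin n → F, ∀ W : Submodule F (Fin n → F),
      W ∈ 𝒞 ↔ ∃ i, 1 ≤ i ∧ i ≤ n ∧ W = Submodule.span F (v '' {j | (j : ℕ) < i}) := by
  have hle : ∀ W ∈ 𝒞, ∀ W' ∈ 𝒞, Module.finrank F W ≤ Module.finrank F W' → W ≤ W' := by
    intro W hW W' hW' h
    rcases hchain.total hW hW' with h1 | h1
    · exact h1
    · exact (Submodule.eq_of_le_of_finrank_le h1 h).ge
  have hinj : Set.InjOn (fun W : Submodule F (Fin n → F) => Module.finrank F W) 𝒞 :=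
    fun W hW W' hW' h => le_antisymm (hle W hW W' hW' h.le) (hle W' hW' W hW h.ge)
  -- The dimension is injective on a chain. With `n` members, all nonzero, every value from `1` to
  -- `n` occurs.
  have himage : (fun W : Submodule F (Fin n → F) => Module.finrank F W) '' 𝒞 = Set.Icc 1 n := by
    refine Set.eq_of_subset_of_ncard_le ?_ ?_ (Set.finite_Icc 1 n)
    · rintro _ ⟨W, hW, rfl⟩
      refine ⟨Nat.one_le_iff_ne_zero.2 fun h => hbot ?_, ?_⟩
      · rwa [Submodule.finrank_eq_zero.1 h] at hW
      · simpa using Submodule.finrank_le W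
    · rw [hinj.ncard_image, hcard, Set.ncard_eq_toFinset_card']
      simp
  have hex : ∀ i, 1 ≤ i → i ≤ n → ∃ W ∈ 𝒞, Module.finrank F W = i := by
    intro i h1 h2
    have : i ∈ Set.Icc 1 n := ⟨h1, h2⟩
    rwa [← himage] at this
  -- For `1 ≤ i ≤ n` this is the member of dimension `i`; at `i = 0` the supremum is empty and gives
  -- the zero subspace that starts the flag.
  let W : ℕ → Submodule F (Fin n → F) := fun i => sSup {U | U ∈ 𝒞 ∧ Module.finrank F U ≤ i}
  have hW : ∀ U ∈ 𝒞, W (Module.finrank F U) = U := by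
    intro U hU
    exact le_antisymm (sSup_le fun U' hU' => hle U' hU'.1 U hU hU'.2) (le_sSup ⟨hU, le_rfl⟩)
  have hmono : Monotone W := fun i j hij => sSup_le_sSup fun U hU => ⟨hU.1, hU.2.trans hij⟩
  have hrank : ∀ i ≤ n, Module.finrank F (W i) = i := by
    intro i hi
    rcases Nat.eq_zero_or_pos i with rfl | hpos
    · have : W 0 = ⊥ := by
        refine sSup_eq_bot.2 fun U hU => ?_
        exact Submodule.finrank_eq_zero.1 (Nat.le_zero.1 hU.2)
      rw [this, finrank_bot]
    · obtain ⟨U, hU, rfl⟩ := hex i hpos hi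
      rw [hW U hU]
  obtain ⟨v, hv⟩ := exists_span_image_eq W hmono hrank
  refine ⟨v, fun U => ⟨fun hU => ?_, ?_⟩⟩
  · have : Module.finrank F U ∈ Set.Icc 1 n := himage ▸ Set.mem_image_of_mem _ hU
    exact ⟨_, this.1, this.2, by rw [hv _ this.2, hW U hU]⟩
  · rintro ⟨i, h1, h2, rfl⟩
    obtain ⟨U, hU, rfl⟩ := hex i h1 h2
    rwa [hv _ h2, hW U hU]

/-! ### Chambers at a vertex as flags modulo the uniformizer. -/

section Building

variable {𝔽 : Type v} [Field 𝔽] {n : ℕ}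

/-- The lattice `c⁻¹ L`. -/
noncomputable def BTLattice.scale (c : 𝔽⸨X⸩) (hc : c ≠ 0) (L : BTLattice 𝔽 n) : BTLattice 𝔽 n :=
  L.map (LinearEquiv.smulOfNeZero 𝔽⸨X⸩ (Fin n → 𝔽⸨X⸩) c hc).symm

theorem BTLattice.mem_scale {c : 𝔽⸨X⸩} {hc : c ≠ 0} {L : BTLattice 𝔽 n} {x : Fin n → 𝔽⸨X⸩} :
    x ∈ (L.scale c hc).carrier ↔ c • x ∈ L.carrier :=
  BTLattice.mem_map

theorem BTLattice.toVertex_scale {c : 𝔽⸨X⸩} {hc : c ≠ 0} {L : BTLattice 𝔽 n} :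
    (L.scale c hc).toVertex = L.toVertex :=
  (toVertex_eq_iff.2 ⟨c, hc, fun _ => mem_scale⟩).symm

/-- The uniformizer. -/
noncomputable def unif (𝔽 : Type v) [Field 𝔽] : 𝔽⸨X⸩ :=
  algebraMap 𝔽⟦X⟧ 𝔽⸨X⸩ PowerSeries.X

theorem unif_ne_zero : unif 𝔽 ≠ 0 :=
  (map_ne_zero_iff _ (IsFractionRing.injective 𝔽⟦X⟧ 𝔽⸨X⸩)).2 PowerSeries.X_ne_zero

theorem X_smul (x : Fin n → 𝔽⸨X⸩) : (PowerSeries.X : 𝔽⟦X⟧) • x = unif 𝔽 • x :=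
  (algebraMap_smul 𝔽⸨X⸩ (PowerSeries.X : 𝔽⟦X⟧) x).symm

/-- `N` lies between `L` and `t L`. -/
def BTLattice.Near (L N : BTLattice 𝔽 n) : Prop :=
  N.carrier ≤ L.carrier ∧ ∀ x ∈ L.carrier, (PowerSeries.X : 𝔽⟦X⟧) • x ∈ N.carrier

/-- The vertices of a simplex that contains the class of `L` are represented by a chain of lattices
between `L` and `t L`. -/
theorem IsSimplex.exists_near {σ : Set (BTVertex 𝔽 n)} (h : IsSimplex σ) {L : BTLattice 𝔽 n}
    (hL : L.toVertex ∈ σ) :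
    ∃ M : BTVertex 𝔽 n → BTLattice 𝔽 n, M L.toVertex = L ∧
      (∀ a ∈ σ, (M a).toVertex = a ∧ L.Near (M a)) ∧
      ∀ a ∈ σ, ∀ b ∈ σ, (M a).carrier ≤ (M b).carrier ∨ (M b).carrier ≤ (M a).carrier := by
  classical
  obtain ⟨r, hr, hr'⟩ := h
  obtain ⟨c, hc, hcL⟩ := BTLattice.toVertex_eq_iff.1 (hr _ hL)
  let s : BTVertex 𝔽 n → BTLattice 𝔽 n := fun a => (r a).scale c hc
  have hsL : s L.toVertex = L :=
    BTLattice.ext_carrier (Submodule.ext fun x => BTLattice.mem_scale.trans (hcL x).symm)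
  have hs : ∀ a ∈ σ, (s a).toVertex = a := fun a ha => BTLattice.toVertex_scale.trans (hr a ha)
  have htot : ∀ a ∈ σ, ∀ b ∈ σ,
      (s a).carrier ≤ (s b).carrier ∨ (s b).carrier ≤ (s a).carrier := fun a ha b hb =>
    (hr' a ha b hb).1.imp
      (fun h x hx => BTLattice.mem_scale.2 (h (BTLattice.mem_scale.1 hx)))
      (fun h x hx => BTLattice.mem_scale.2 (h (BTLattice.mem_scale.1 hx)))
  have hX : ∀ a ∈ σ, ∀ b ∈ σ, ∀ x ∈ (s a).carrier,
      (PowerSeries.X : 𝔽⟦X⟧) • x ∈ (s b).carrier := by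
    intro a ha b hb x hx
    have := (hr' a ha b hb).2 _ (BTLattice.mem_scale.1 hx)
    rw [X_smul] at this ⊢
    rw [smul_comm] at this
    exact BTLattice.mem_scale.2 this
  have hinv : (unif 𝔽)⁻¹ ≠ 0 := inv_ne_zero unif_ne_zero
  have hXinv : ∀ x : Fin n → 𝔽⸨X⸩, (PowerSeries.X : 𝔽⟦X⟧) • ((unif 𝔽)⁻¹ • x) = x := fun x => by
    rw [X_smul, smul_inv_smul₀ unif_ne_zero]
  have hdown : ∀ a ∈ σ, ∀ b ∈ σ, ((s a).scale _ hinv).carrier ≤ (s b).carrier := by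
    intro a ha b hb x hx
    have := hX a ha b hb _ (BTLattice.mem_scale.1 hx)
    rwa [hXinv] at this
  -- After rescaling so that `L` represents its own class, a representative not contained in `L`
  -- contains `L`. Multiplying it by `t` puts it between `L` and `t L`.
  let M : BTVertex 𝔽 n → BTLattice 𝔽 n := fun a =>
    if (s a).carrier ≤ L.carrier then s a else (s a).scale _ hinv
  have hM1 : ∀ a, (s a).carrier ≤ L.carrier → M a = s a := fun a ha => if_pos ha
  have hM2 : ∀ a, ¬(s a).carrier ≤ L.carrier → M a = (s a).scale _ hinv := fun a ha => if_neg ha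
  refine ⟨M, ?_, fun a ha => ?_, fun a ha b hb => ?_⟩
  · rw [hM1 _ (by rw [hsL]), hsL]
  · by_cases hle : (s a).carrier ≤ L.carrier
    · rw [hM1 a hle]
      refine ⟨hs a ha, hle, fun x hx => ?_⟩
      have := hX _ hL a ha x
      rw [hsL] at this
      exact this hx
    · rw [hM2 a hle]
      refine ⟨BTLattice.toVertex_scale.trans (hs a ha), ?_, fun x hx => ?_⟩
      · have := hdown a ha _ hL
        rwa [hsL] at this
      · have h1 := htot a ha _ hL
        rw [hsL] at h1
        rw [BTLattice.mem_scale, X_smul, inv_smul_smul₀ unif_ne_zero]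
        exact h1.resolve_left hle hx
  · by_cases hla : (s a).carrier ≤ L.carrier <;> by_cases hlb : (s b).carrier ≤ L.carrier
    · rw [hM1 a hla, hM1 b hlb]; exact htot a ha b hb
    · rw [hM1 a hla, hM2 b hlb]; exact Or.inr (hdown b hb a ha)
    · rw [hM2 a hla, hM1 b hlb]; exact Or.inl (hdown a ha b hb)
    · rw [hM2 a hla, hM2 b hlb]
      exact (htot a ha b hb).imp
        (fun h x hx => BTLattice.mem_scale.2 (h (BTLattice.mem_scale.1 hx)))
        (fun h x hx => BTLattice.mem_scale.2 (h (BTLattice.mem_scale.1 hx)))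

/-- The combination of the vectors `b` with constant coefficients `c`. -/
noncomputable def constComb (b : Fin n → Fin n → 𝔽⸨X⸩) (c : Fin n → 𝔽) : Fin n → 𝔽⸨X⸩ :=
  ∑ i, (PowerSeries.C (c i) : 𝔽⟦X⟧) • b i

/-- The subspace of `𝔽ⁿ` that corresponds to the image of a lattice modulo `t`. -/
noncomputable def constSub (b : Fin n → Fin n → 𝔽⸨X⸩) (N : BTLattice 𝔽 n) :
    Submodule 𝔽 (Fin n → 𝔽) where
  carrier := {c | constComb b c ∈ N.carrier}
  zero_mem' := by
    change constComb b 0 ∈ N.carrier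
    simp [constComb]
  add_mem' := by
    intro c c' h h'
    change constComb b (c + c') ∈ N.carrier
    have : constComb b (c + c') = constComb b c + constComb b c' := by
      simp [constComb, add_smul, Finset.sum_add_distrib]
    rw [this]
    exact N.carrier.add_mem h h'
  smul_mem' := by
    intro k c h
    change constComb b (k • c) ∈ N.carrier
    have : constComb b (k • c) = (PowerSeries.C k : 𝔽⟦X⟧) • constComb b c := by
      simp [constComb, Finset.smul_sum, mul_smul]
    rw [this]
    exact N.carrier.smul_mem _ h

theorem mem_constSub {b : Fin n → Fin n → 𝔽⸨X⸩} {N : BTLattice 𝔽 n} {c : Fin n → 𝔽} :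
    c ∈ constSub b N ↔ constComb b c ∈ N.carrier := Iff.rfl

/-- Elements of a lattice are constant combinations of a basis modulo `t`. -/
theorem BTLattice.exists_constComb_add {b : Fin n → Fin n → 𝔽⸨X⸩} {L : BTLattice 𝔽 n}
    (hb : L.carrier = Submodule.span 𝔽⟦X⟧ (Set.range b)) {x : Fin n → 𝔽⸨X⸩}
    (hx : x ∈ L.carrier) :
    ∃ c, ∃ y ∈ L.carrier, x = constComb b c + (PowerSeries.X : 𝔽⟦X⟧) • y := by
  rw [hb, Submodule.mem_span_range_iff_exists_fun] at hx
  obtain ⟨r, rfl⟩ := hx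
  have hr : ∀ i, ∃ s : 𝔽⟦X⟧,
      r i = PowerSeries.C (PowerSeries.constantCoeff (r i)) + PowerSeries.X * s := by
    intro i
    exact ⟨_, (PowerSeries.eq_X_mul_shift_add_const (r i)).trans (add_comm _ _)⟩
  choose s hs using hr
  refine ⟨fun i => PowerSeries.constantCoeff (r i), ∑ i, s i • b i, ?_, ?_⟩
  · rw [hb]
    exact Submodule.sum_mem _ fun i _ =>
      Submodule.smul_mem _ _ (Submodule.subset_span (Set.mem_range_self i))
  · rw [constComb, Finset.smul_sum, ← Finset.sum_add_distrib]
    refine Finset.sum_congr rfl fun i _ => ?_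
    rw [← mul_smul, ← add_smul, ← hs i]

/-- A lattice between `L` and `t L` is determined by its image in `L / tL`, which the basis
identifies with `𝔽ⁿ`. Elements are compared through their constant parts, since `t L` lies in both
lattices. -/
theorem BTLattice.Near.le_of_constSub_le {b : Fin n → Fin n → 𝔽⸨X⸩} {L N N' : BTLattice 𝔽 n}
    (hb : L.carrier = Submodule.span 𝔽⟦X⟧ (Set.range b)) (hN : L.Near N) (hN' : L.Near N')
    (h : constSub b N ≤ constSub b N') : N.carrier ≤ N'.carrier := by
  intro x hx
  obtain ⟨c, y, hy, rfl⟩ := exists_constComb_add hb (hN.1 hx)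
  have hc : constComb b c ∈ N.carrier := by
    have := N.carrier.sub_mem hx (hN.2 y hy)
    rwa [add_sub_cancel_right] at this
  exact N'.carrier.add_mem (mem_constSub.1 (h (mem_constSub.2 hc))) (hN'.2 y hy)

theorem BTLattice.Near.eq_of_constSub_eq {b : Fin n → Fin n → 𝔽⸨X⸩} {L N N' : BTLattice 𝔽 n}
    (hb : L.carrier = Submodule.span 𝔽⟦X⟧ (Set.range b)) (hN : L.Near N) (hN' : L.Near N')
    (h : constSub b N = constSub b N') : N = N' :=
  ext_carrier (le_antisymm (hN.le_of_constSub_le hb hN' h.le) (hN'.le_of_constSub_le hb hN h.ge))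

/-- A zero image modulo `t` forces `N` to be `t L`, which is homothetic to `L`. -/
theorem BTLattice.Near.toVertex_eq {b : Fin n → Fin n → 𝔽⸨X⸩} {L N : BTLattice 𝔽 n}
    (hb : L.carrier = Submodule.span 𝔽⟦X⟧ (Set.range b)) (hN : L.Near N)
    (h : constSub b N = ⊥) : L.toVertex = N.toVertex := by
  refine toVertex_eq_iff.2
    ⟨(unif 𝔽)⁻¹, inv_ne_zero unif_ne_zero, fun x => ⟨fun hx => ?_, fun hx => ?_⟩⟩
  · obtain ⟨c, y, hy, rfl⟩ := exists_constComb_add hb (hN.1 hx)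
    have hc : c ∈ constSub b N := by
      have := N.carrier.sub_mem hx (hN.2 y hy)
      rwa [add_sub_cancel_right] at this
    rw [h, Submodule.mem_bot] at hc
    subst hc
    have : constComb b (0 : Fin n → 𝔽) = 0 := by simp [constComb]
    rwa [this, zero_add, X_smul, inv_smul_smul₀ unif_ne_zero]
  · have := hN.2 _ hx
    rwa [X_smul, smul_inv_smul₀ unif_ne_zero] at this

theorem constSub_self {b : Fin n → Fin n → 𝔽⸨X⸩} {L : BTLattice 𝔽 n}
    (hb : L.carrier = Submodule.span 𝔽⟦X⟧ (Set.range b)) : constSub b L = ⊤ := by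
  refine eq_top_iff.2 fun c _ => ?_
  rw [mem_constSub, hb]
  exact Submodule.sum_mem _ fun i _ =>
    Submodule.smul_mem _ _ (Submodule.subset_span (Set.mem_range_self i))

/-- A vertex of the building is in at most `q ^ (n ^ 2)` chambers. -/
theorem chambersAt_finite_and_ncard_le [Fintype 𝔽] [NeZero n] (a : BTVertex 𝔽 n) :
    (chambersAt a).Finite ∧ (chambersAt a).ncard ≤ Fintype.card 𝔽 ^ (n ^ 2) := by
  classical
  obtain ⟨L, rfl⟩ := exists_toVertex a
  obtain ⟨b, hb⟩ := L.exists_basis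
  -- A tuple of vectors is sent to the vertices whose lattices reduce to the spans of its initial
  -- segments. Every chamber at the vertex arises this way, so counting tuples bounds the number of
  -- chambers.
  let Φ : (Fin n → Fin n → 𝔽) → Set (BTVertex 𝔽 n) := fun v =>
    {a | ∃ N : BTLattice 𝔽 n, N.toVertex = a ∧ L.Near N ∧ ∃ i, 1 ≤ i ∧ i ≤ n ∧
      constSub b N = Submodule.span 𝔽 (v '' {j | (j : ℕ) < i})}
  have hsub : chambersAt L.toVertex ⊆ Set.range Φ := by
    rintro σ ⟨hσ, hL, hcard⟩
    obtain ⟨M, hML, hM, htot⟩ := hσ.exists_near hL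
    have hinj : Set.InjOn (fun a => constSub b (M a)) σ := by
      intro a ha a' ha' h
      rw [← (hM a ha).1, ← (hM a' ha').1, (hM a ha).2.eq_of_constSub_eq hb (hM a' ha').2 h]
    obtain ⟨v, hv⟩ := exists_span_image_eq_of_isChain (𝒞 := (fun a => constSub b (M a)) '' σ)
      (by
        rintro _ ⟨a, ha, rfl⟩ _ ⟨a', ha', rfl⟩ -
        exact (htot a ha a' ha').imp (fun h _ hc => h hc) (fun h _ hc => h hc))
      (by
        -- A zero image would make `a` the class of `L`, whose chosen representative is `L` itself
        -- with full image; `n ≠ 0` makes this a contradiction.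
        rintro ⟨a, ha, h0⟩
        have h1 := (hM a ha).2.toVertex_eq hb h0
        rw [(hM a ha).1] at h1
        rw [← h1] at h0
        simp only [hML, constSub_self hb] at h0
        exact top_ne_bot h0)
      ((hinj.ncard_image).trans hcard)
    refine ⟨v, Set.ext fun a => ⟨?_, fun ha => ?_⟩⟩
    · rintro ⟨N, rfl, hN, hi⟩
      obtain ⟨i, h1, h2, h3⟩ := hi
      obtain ⟨a', ha', h4⟩ := (hv _).2 ⟨i, h1, h2, h3⟩
      rw [← (hM a' ha').2.eq_of_constSub_eq hb hN h4, (hM a' ha').1]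
      exact ha'
    · exact ⟨M a, (hM a ha).1, (hM a ha).2, (hv _).1 ⟨a, ha, rfl⟩⟩
  refine ⟨(Set.finite_range Φ).subset hsub, ?_⟩
  calc (chambersAt L.toVertex).ncard ≤ (Set.range Φ).ncard :=
        Set.ncard_le_ncard hsub (Set.finite_range Φ)
    _ ≤ Nat.card (Fin n → Fin n → 𝔽) := by
        rw [← Set.image_univ, ← Set.ncard_univ]
        exact Set.ncard_image_le Set.finite_univ
    _ = Fintype.card 𝔽 ^ (n ^ 2) := by
        rw [Nat.card_eq_fintype_card]
        simp only [Fintype.card_pi, Finset.prod_const, Finset.card_univ, Fintype.card_fin]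
        rw [← pow_mul, sq]

end Building

/-! ### Vertex degrees in a quotient of the building. -/

section Quotient

variable {𝔽 : Type v} [Field 𝔽] {V : Type u} [DecidableEq V] {k : ℕ}

/-- The top faces of a quotient of the building at a vertex correspond to the chambers at a lift. -/
theorem card_layer_filter_mem {Y : PureComplex V k}
    {Γ : Subgroup (Matrix.GeneralLinearGroup (Fin (k + 1)) 𝔽⸨X⸩)} {p : BTVertex 𝔽 (k + 1) → V}
    (hp : ∀ a b, p a = p b ↔ SameOrbit Γ a b)
    (hfaces : ∀ s : Finset V, s ∈ Y.faces ↔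
      ∃ σ : Set (BTVertex 𝔽 (k + 1)), IsSimplex σ ∧ p '' σ = ↑s)
    (hstar : ∀ a b c, IsSimplex {a, b} → IsSimplex {a, c} → SameOrbit Γ b c → b = c)
    (a : BTVertex 𝔽 (k + 1)) :
    ((Y.layer (k + 1)).filter (fun t => p a ∈ t)).card = (chambersAt a).ncard := by
  have hpair : ∀ {σ : Set (BTVertex 𝔽 (k + 1))}, IsSimplex σ → ∀ b ∈ σ, ∀ c ∈ σ,
      IsSimplex {b, c} := fun hσ b hb c hc =>
    hσ.subset (Set.insert_subset hb (Set.singleton_subset_iff.2 hc))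
  have hinj : ∀ {σ : Set (BTVertex 𝔽 (k + 1))}, IsSimplex σ → Set.InjOn p σ :=
    fun hσ b hb c hc h => hstar b b c (hpair hσ b hb b hb) (hpair hσ b hb c hc) ((hp b c).1 h)
  have himage : (fun t : Finset V => (t : Set V)) ''
      ↑((Y.layer (k + 1)).filter (fun t => p a ∈ t)) = (fun σ => p '' σ) '' chambersAt a := by
    refine Set.Subset.antisymm ?_ ?_
    · rintro _ ⟨t, ht, rfl⟩
      obtain ⟨ht, hat⟩ := Finset.mem_filter.1 ht
      obtain ⟨ht, hc⟩ := PureComplex.mem_layer.1 ht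
      obtain ⟨σ, hσ, hσt⟩ := (hfaces t).1 ht
      have : p a ∈ p '' σ := by rw [hσt]; exact hat
      obtain ⟨a', ha', haa'⟩ := this
      -- A lift of `t` may pass through another point of the orbit of `a`; an element of `Γ` moves
      -- it to pass through `a`.
      obtain ⟨e, he, hΓ⟩ := ((hp a' a).1 haa').exists_vertexMap
      have hσ' : p '' (vertexMap e '' σ) = ↑t := by
        rw [← hσt, Set.image_image]
        exact Set.image_congr fun c _ => ((hp _ _).2 (hΓ c)).symm
      refine ⟨vertexMap e '' σ, ⟨hσ.image e, he ▸ Set.mem_image_of_mem _ ha', ?_⟩, hσ'⟩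
      rw [← (hinj (hσ.image e)).ncard_image, hσ', Set.ncard_coe_finset, hc]
    · rintro _ ⟨σ, ⟨hσ, haσ, hc⟩, rfl⟩
      have hfin : σ.Finite := Set.finite_of_ncard_ne_zero (by omega)
      have ht : ((hfin.image p).toFinset : Set V) = p '' σ := (hfin.image p).coe_toFinset
      refine ⟨(hfin.image p).toFinset, ?_, ht⟩
      refine Finset.mem_coe.2 (Finset.mem_filter.2 ⟨PureComplex.mem_layer.2
        ⟨(hfaces _).2 ⟨σ, hσ, ht.symm⟩, ?_⟩, ?_⟩)
      · rw [← Set.ncard_coe_finset, ht, (hinj hσ).ncard_image, hc]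
      · rw [Set.Finite.mem_toFinset]
        exact Set.mem_image_of_mem _ haσ
  -- Two chambers at `a` lie in the star of `a`, where each orbit has at most one point, so equal
  -- images force equal chambers.
  have hinj' : Set.InjOn (fun σ => p '' σ) (chambersAt a) := by
    have hsub : ∀ σ ∈ chambersAt a, ∀ τ ∈ chambersAt a, p '' σ = p '' τ → σ ⊆ τ := by
      rintro σ ⟨hσ, haσ, -⟩ τ ⟨hτ, haτ, -⟩ h b hb
      have : p b ∈ p '' τ := h ▸ Set.mem_image_of_mem p hb
      obtain ⟨c, hc, hcb⟩ := this
      rw [hstar a b c (hpair hσ a haσ b hb) (hpair hτ a haτ c hc) ((hp b c).1 hcb.symm)]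
      exact hc
    exact fun σ hσ τ hτ h =>
      Set.Subset.antisymm (hsub σ hσ τ hτ h) (hsub τ hτ σ hσ (Eq.symm h))
  rw [← hinj'.ncard_image, ← himage, Set.ncard_image_of_injective _ Finset.coe_injective,
    Set.ncard_coe_finset]

/-- All vertices of a quotient of the building are in the same number of top faces. -/
theorem IsBuildingQuotient.exists_degree [Fintype 𝔽] {Y : WeightedComplex V k}
    (hY : IsBuildingQuotient 𝔽 Y.toPureComplex) :
    ∃ N : ℕ, N ≤ Fintype.card 𝔽 ^ ((k + 1) ^ 2) ∧
      ∀ x ∈ Y.verts, ((Y.layer (k + 1)).filter (fun t => x ∈ t)).card = N := by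
  obtain ⟨Γ, p, hp, hfaces, hstar⟩ := hY
  have hlift : ∀ x ∈ Y.verts, ∃ a, p a = x := by
    intro x hx
    obtain ⟨σ, -, h⟩ := (hfaces {x}).1 (Y.mem_verts.1 hx)
    have : x ∈ p '' σ := by rw [h]; simp
    obtain ⟨a, -, ha⟩ := this
    exact ⟨a, ha⟩
  rcases Y.verts.eq_empty_or_nonempty with h0 | ⟨x₀, hx₀⟩
  · exact ⟨0, Nat.zero_le _, by simp [h0]⟩
  · obtain ⟨a₀, -⟩ := hlift x₀ hx₀
    refine ⟨(chambersAt a₀).ncard, (chambersAt_finite_and_ncard_le a₀).2, fun x hx => ?_⟩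
    obtain ⟨a, rfl⟩ := hlift x hx
    rw [card_layer_filter_mem hp hfaces hstar a, ncard_chambersAt a a₀]

end Quotient

/-! ### Truncations, uniformity and flatness. -/

theorem PureComplex.layer_top_card_pos {V : Type u} {k : ℕ} (Y : PureComplex V k) :
    0 < (Y.layer (k + 1)).card := by
  obtain ⟨t, ht, -, hc⟩ := Y.pure ∅ Y.empty_mem_faces
  exact Finset.card_pos.2 ⟨t, PureComplex.mem_layer.2 ⟨ht, hc⟩⟩

namespace WeightedComplex

variable {V : Type u} [DecidableEq V] {d k : ℕ} {X : WeightedComplex V d}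
  {Y : WeightedComplex V k}

theorem IsTruncationOf.le (h : X.IsTruncationOf Y) : d ≤ k := by
  obtain ⟨t, ht, -, hc⟩ := X.pure ∅ X.empty_mem_faces
  rw [h.1, Finset.mem_filter] at ht
  have := Y.card_le t ht.1
  omega

theorem IsTruncationOf.layer_eq (h : X.IsTruncationOf Y) {m : ℕ} (hm : m ≤ d + 1) :
    X.layer m = Y.layer m := by
  ext s
  rw [PureComplex.mem_layer, PureComplex.mem_layer, h.1, Finset.mem_filter]
  constructor
  · rintro ⟨⟨h1, -⟩, h2⟩
    exact ⟨h1, h2⟩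
  · rintro ⟨h1, h2⟩
    exact ⟨⟨h1, h2.trans_le hm⟩, h2⟩

theorem IsTruncationOf.verts_eq (h : X.IsTruncationOf Y) : X.verts = Y.verts := by
  ext x
  rw [mem_verts, mem_verts, h.1, Finset.mem_filter, Finset.card_singleton]
  simp

/-- Removing random points in two stages is the same as removing them at once, so the truncation
inherits every lower distribution of `Y`. -/
theorem IsTruncationOf.faceProb_eq (h : X.IsTruncationOf Y) {s : Finset V}
    (hs : s.card ≤ d + 1) : X.faceProb s = Y.faceProb s := by
  have hch : ((d + 1).choose s.card : ℝ) ≠ 0 := by exact_mod_cast (Nat.choose_pos hs).ne'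
  rw [faceProb, Finset.sum_congr rfl fun t ht => by rw [h.2 t (Finset.mem_filter.1 ht).1],
    ← Finset.sum_div, h.layer_eq le_rfl,
    Y.sum_faceProb_superset hs (Nat.succ_le_succ h.le), mul_div_cancel_left₀ _ hch]

theorem IsUniform.faceProb_eq (hY : Y.IsUniform) (s : Finset V) :
    Y.faceProb s = (((Y.layer (k + 1)).filter (fun t => s ⊆ t)).card : ℝ) /
      ((Y.layer (k + 1)).card * (k + 1).choose s.card) := by
  rw [faceProb, Finset.sum_congr rfl fun t ht => by rw [hY t (Finset.mem_filter.1 ht).1],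
    Finset.sum_const, nsmul_eq_mul]
  rw [div_div, mul_one_div]

theorem verts_card_pos : 0 < Y.verts.card := by
  obtain ⟨t, ht, -, hc⟩ := Y.pure ∅ Y.empty_mem_faces
  obtain ⟨x, hx⟩ := Finset.card_pos.1 (by omega : 0 < t.card)
  exact Finset.card_pos.2 ⟨x, Y.mem_verts_of_mem ht hx⟩

/-- Equal degrees give all vertices the same probability, and these probabilities add to one. -/
theorem IsUniform.faceProb_singleton {N : ℕ}
    (hN : ∀ x ∈ Y.verts, ((Y.layer (k + 1)).filter (fun t => x ∈ t)).card = N)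
    (hY : Y.IsUniform) {x : V} (hx : x ∈ Y.verts) :
    Y.faceProb {x} = 1 / (Y.verts.card : ℝ) := by
  have hc : ∀ y ∈ Y.verts, Y.faceProb {y} = (N : ℝ) / ((Y.layer (k + 1)).card * (k + 1)) := by
    intro y hy
    rw [hY.faceProb_eq]
    simp_rw [Finset.singleton_subset_iff]
    rw [hN y hy]
    simp
  have hsum := Y.sum_faceProb_layer (m := 1) (by omega)
  rw [sum_layer_one, Finset.sum_congr rfl hc, Finset.sum_const, nsmul_eq_mul] at hsum
  have : (0 : ℝ) < Y.verts.card := by exact_mod_cast verts_card_pos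
  rw [hc x hx, eq_div_iff this.ne', mul_comm, hsum]

theorem card_verts_mul {N : ℕ}
    (hN : ∀ x ∈ Y.verts, ((Y.layer (k + 1)).filter (fun t => x ∈ t)).card = N) :
    Y.verts.card * N = (Y.layer (k + 1)).card * (k + 1) := by
  have h := Finset.sum_card_bipartiteAbove_eq_sum_card_bipartiteBelow (s := Y.verts)
    (t := Y.layer (k + 1)) (fun x t => x ∈ t)
  rw [Finset.sum_congr rfl (show ∀ x ∈ Y.verts,
      (Finset.bipartiteAbove (fun x t => x ∈ t) (Y.layer (k + 1)) x).card = N from hN),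
    Finset.sum_congr rfl (show ∀ t ∈ Y.layer (k + 1),
      (Finset.bipartiteBelow (fun x t => x ∈ t) Y.verts t).card = k + 1 from fun t ht => by
        rw [Finset.bipartiteBelow, filter_verts_mem (PureComplex.mem_layer.1 ht).1,
          (PureComplex.mem_layer.1 ht).2])] at h
  simpa using h

/-- Every face lies in a top face, which has `2 ^ (k + 1)` subsets, and there are at most `N` top
faces per vertex. -/
theorem card_layer_le {N : ℕ}
    (hN : ∀ x ∈ Y.verts, ((Y.layer (k + 1)).filter (fun t => x ∈ t)).card = N)
    (m : ℕ) : (Y.layer m).card ≤ Y.verts.card * (2 ^ (k + 1) * N) := by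
  have hsub : Y.layer m ⊆ (Y.layer (k + 1)).biUnion Finset.powerset := by
    intro s hs
    obtain ⟨t, ht, hst, hc⟩ := Y.pure s (PureComplex.mem_layer.1 hs).1
    exact Finset.mem_biUnion.2
      ⟨t, PureComplex.mem_layer.2 ⟨ht, hc⟩, Finset.mem_powerset.2 hst⟩
  have h1 : (Y.layer m).card ≤ (Y.layer (k + 1)).card * 2 ^ (k + 1) := by
    refine (Finset.card_le_card hsub).trans (Finset.card_biUnion_le_card_mul _ _ _ fun t ht => ?_)
    rw [Finset.card_powerset, (PureComplex.mem_layer.1 ht).2]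
  have h2 : (Y.layer (k + 1)).card ≤ Y.verts.card * N := by
    rw [card_verts_mul hN]
    exact Nat.le_mul_of_pos_right _ (Nat.succ_pos k)
  calc _ ≤ _ := h1
    _ ≤ Y.verts.card * N * 2 ^ (k + 1) := Nat.mul_le_mul_right _ h2
    _ = _ := by ring

/-- The numerator of a face probability is the number of top faces through the face. It is at least
one by purity, and at most the degree of any vertex of the face, which exists because `1 ≤ m`. -/
theorem IsUniform.isFlat {N : ℕ}
    (hN : ∀ x ∈ Y.verts, ((Y.layer (k + 1)).filter (fun t => x ∈ t)).card = N)
    (hY : Y.IsUniform) {m D : ℕ} (hm1 : 1 ≤ m) (hm : m ≤ k + 1)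
    (hD : N ≤ D) : IsFlat (Y.layer m) Y.faceProb D := by
  refine ⟨(Y.layer (k + 1)).card * (k + 1).choose m,
    Nat.mul_pos Y.layer_top_card_pos (Nat.choose_pos hm), fun s hs => ?_⟩
  obtain ⟨hsf, hsc⟩ := PureComplex.mem_layer.1 hs
  refine ⟨((Y.layer (k + 1)).filter (fun t => s ⊆ t)).card, ?_, ?_, ?_⟩
  · obtain ⟨t, ht, hst, hc⟩ := Y.pure s hsf
    exact Finset.card_pos.2 ⟨t, Finset.mem_filter.2 ⟨PureComplex.mem_layer.2 ⟨ht, hc⟩, hst⟩⟩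
  · obtain ⟨x, hx⟩ := Finset.card_pos.1 (by omega : 0 < s.card)
    refine le_trans ?_ ((hN x (Y.mem_verts_of_mem hsf hx)).le.trans hD)
    exact Finset.card_le_card (Finset.monotone_filter_right _ fun t _ h => h hx)
  · rw [hY.faceProb_eq, hsc]
    push_cast
    rfl

end WeightedComplex

/-! ### The numerical bound on the degree, and the theorem. -/

/-- `2 ^ n * q ^ (n ^ 2)` is at most exponential in `d ^ 2 / γ ^ 2`. -/
theorem exists_exponent (K : ℝ) (hK : 0 < K) :
    ∃ C : ℝ, 0 < C ∧ ∀ (γ : ℝ) (d k q : ℕ), 0 < γ → γ ≤ 1 / 2 → 1 ≤ d → 2 ≤ q →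
      (k : ℝ) ≤ K * ((d : ℝ) / γ) → (q : ℝ) ≤ K / γ ^ 2 →
      (2 : ℝ) ^ (k + 1) * (q : ℝ) ^ ((k + 1) ^ 2) ≤ (1 / γ) ^ (C * ((d : ℝ) ^ 2 / γ ^ 2)) := by
  -- Since `1 / γ ≥ 2`, the constant `K` is absorbed into `(1 / γ) ^ κ`, so `q` is bounded by a
  -- fixed power of `1 / γ`.
  obtain ⟨κ, hκ⟩ := pow_unbounded_of_one_lt K (one_lt_two (α := ℝ))
  refine ⟨(κ + 2) * (2 * (K + 1) ^ 2), by positivity, fun γ d k q hγ hγ2 hd hq hk hqK => ?_⟩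
  have hinv : 2 ≤ 1 / γ := by rw [le_div_iff₀ hγ]; linarith
  have hinv1 : 1 ≤ 1 / γ := by linarith
  have hd1 : (1 : ℝ) ≤ d := by exact_mod_cast hd
  have hq2 : (2 : ℝ) ≤ q := by exact_mod_cast hq
  have hqle : (q : ℝ) ≤ (1 / γ) ^ (κ + 2) := by
    calc (q : ℝ) ≤ K / γ ^ 2 := hqK
      _ = K * (1 / γ) ^ 2 := by rw [one_div, inv_pow, div_eq_mul_inv]
      _ ≤ (1 / γ) ^ κ * (1 / γ) ^ 2 := by
          refine mul_le_mul_of_nonneg_right ?_ (by positivity)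
          exact hκ.le.trans (pow_le_pow_left₀ two_pos.le hinv κ)
      _ = (1 / γ) ^ (κ + 2) := by rw [pow_add]
  have h1 : (2 : ℝ) ^ (k + 1) * (q : ℝ) ^ ((k + 1) ^ 2) ≤ (q : ℝ) ^ (2 * (k + 1) ^ 2) := by
    rw [two_mul, pow_add (q : ℝ)]
    refine mul_le_mul_of_nonneg_right ?_ (by positivity)
    calc (2 : ℝ) ^ (k + 1) ≤ (q : ℝ) ^ (k + 1) := pow_le_pow_left₀ two_pos.le hq2 _
      _ ≤ _ := pow_le_pow_right₀ (by linarith) (Nat.le_self_pow (by norm_num) _)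
  have h2 : (q : ℝ) ^ (2 * (k + 1) ^ 2) ≤ (1 / γ) ^ ((κ + 2) * (2 * (k + 1) ^ 2)) := by
    rw [pow_mul (1 / γ)]
    exact pow_le_pow_left₀ (by positivity) hqle _
  refine h1.trans (h2.trans ?_)
  rw [← Real.rpow_natCast]
  refine Real.rpow_le_rpow_of_exponent_le hinv1 ?_
  push_cast
  rw [mul_assoc, mul_assoc]
  refine mul_le_mul_of_nonneg_left ?_ (by positivity)
  refine mul_le_mul_of_nonneg_left ?_ two_pos.le
  have hk1 : (k : ℝ) + 1 ≤ (K + 1) * (d / γ) := by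
    have : 1 ≤ (d : ℝ) / γ := by rw [le_div_iff₀ hγ]; linarith
    linarith
  calc ((k : ℝ) + 1) ^ 2 ≤ ((K + 1) * (d / γ)) ^ 2 := pow_le_pow_left₀ (by positivity) hk1 2
    _ = (K + 1) ^ 2 * ((d : ℝ) ^ 2 / γ ^ 2) := by rw [mul_pow, div_pow]

end HDX

theorem lemma5p3 :
    -- spectral bounds and locality, for every complex with a distribution on its top faces
    (∃ C : ℝ, 0 < C ∧
      ∀ (V : Type u) [DecidableEq V] (d : ℕ) (X : HDX.WeightedComplex V d) (m₁ m₂ : ℕ),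
        1 ≤ m₁ → m₁ < m₂ → m₂ ≤ d + 1 → 2 < m₂ →
        (∀ γ : ℝ, X.IsTwoSidedExpander γ →
          X.lambda10 m₁ m₂ ^ 2 ≤ 1 / (m₁ : ℝ) + C * ((m₁ : ℝ) * γ) ∧
          X.lambda21 m₁ m₂ ^ 2 ≤ (m₁ : ℝ) / (m₂ : ℝ) + C * ((m₁ : ℝ) * (m₂ : ℝ) * γ)) ∧
        (∀ T ∈ X.layer m₂,
          (∀ x, X.pi0Given m₁ T x = if x ∈ T then 1 / (T.card : ℝ) else 0) ∧
          X.lambdaLocal m₁ T ^ 2 ≤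
            1 / (m₁ : ℝ) * (((m₂ : ℝ) - (m₁ : ℝ)) / ((m₂ : ℝ) - 1)))) ∧
    -- uniformity and flatness, for truncations of quotients of the building
    (∀ K : ℝ, 0 < K → ∃ C : ℝ, 0 < C ∧
      ∀ (γ : ℝ), 0 < γ → γ ≤ 1 / 2 →
      ∀ (𝔽 : Type v) [Field 𝔽] [Fintype 𝔽] (V : Type u) [DecidableEq V] (d k : ℕ)
        (X : HDX.WeightedComplex V d) (Y : HDX.WeightedComplex V k) (m₁ m₂ : ℕ),
        HDX.IsBuildingQuotient 𝔽 Y.toPureComplex → Y.IsUniform → X.IsTruncationOf Y →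
        (k : ℝ) ≤ K * ((d : ℝ) / γ) → (Fintype.card 𝔽 : ℝ) ≤ K / γ ^ 2 →
        1 ≤ m₁ → m₁ < m₂ → m₂ ≤ d + 1 → 2 < m₂ →
        (∀ x ∈ X.verts, X.faceProb {x} = 1 / (X.verts.card : ℝ)) ∧
        ∃ D : ℕ, (D : ℝ) ≤ (1 / γ) ^ (C * ((d : ℝ) ^ 2 / γ ^ 2)) ∧
          HDX.IsFlat (X.layer m₁) (X.pi1 m₁ m₂) D ∧
          ((X.layer (d + 1)).card : ℝ) / (X.verts.card : ℝ) ≤ (D : ℝ)) := by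
  refine ⟨⟨1, one_pos, ?_⟩, ?_⟩
  · intro V _ d X m₁ m₂ h1 h12 h2 h3
    refine ⟨fun γ hX => ?_, fun T hT => ⟨fun x => HDX.WeightedComplex.pi0Given_eq h1 h12.le hT x,
      HDX.WeightedComplex.lambdaLocal_sq_le h1 h12 hT⟩⟩
    have hγ := hX.nonneg (by omega)
    rw [one_mul, one_mul]
    exact ⟨hX.lambda10_sq_le hγ h1 h12.le h2, hX.lambda21_sq_le hγ h1 h12.le h2⟩
  · intro K hK
    obtain ⟨C, hC, hbound⟩ := HDX.exists_exponent K hK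
    refine ⟨C, hC, ?_⟩
    intro γ hγ hγ2 𝔽 _ _ V _ d k X Y m₁ m₂ hY hU hXY hk hq h1 h12 h2 h3
    obtain ⟨N, hNle, hN⟩ := hY.exists_degree
    -- In this choice of `D`, the power of `q` bounds the degree and already suffices for flatness;
    -- the factor `2 ^ (k + 1)` pays for the subsets of top faces in the count of `d`-faces.
    refine ⟨fun x hx => ?_, 2 ^ (k + 1) * Fintype.card 𝔽 ^ ((k + 1) ^ 2), ?_, ?_, ?_⟩
    · rw [hXY.faceProb_eq (by simp), hXY.verts_eq]
      exact HDX.WeightedComplex.IsUniform.faceProb_singleton hN hU (hXY.verts_eq ▸ hx)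
    · push_cast
      exact hbound γ d k _ hγ hγ2 (by omega) Fintype.one_lt_card hk hq
    · have hdk := hXY.le
      obtain ⟨R, hR, hflat⟩ := HDX.WeightedComplex.IsUniform.isFlat hN hU h1 (by omega : m₁ ≤ k + 1)
        (hNle.trans (Nat.le_mul_of_pos_left _ (by positivity : 0 < 2 ^ (k + 1))))
      refine ⟨R, hR, fun S hS => ?_⟩
      have hSc := (HDX.PureComplex.mem_layer.1 hS).2
      rw [HDX.WeightedComplex.pi1_eq h1 h12.le h2 hS, hXY.faceProb_eq (by omega)]
      exact hflat S (hXY.layer_eq (h12.le.trans h2) ▸ hS)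
    · have hpos : (0 : ℝ) < Y.verts.card := by
        exact_mod_cast HDX.WeightedComplex.verts_card_pos
      rw [hXY.layer_eq le_rfl, hXY.verts_eq, div_le_iff₀ hpos]
      have := (HDX.WeightedComplex.card_layer_le hN (d + 1)).trans
        (Nat.mul_le_mul_left _ (Nat.mul_le_mul_left _ hNle))
      rw [mul_comm] at this
      exact_mod_cast this
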